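/- Fix polynomial degrees $p,q\ge 0$. **T-meshes.** A T-mesh is a partition of an index domain $[1,m]\times[1,n]$ into rectangular cells with integer corners. Its vertices are the corners of the cells; its horizontal (vertical) skeleton is the union of the horizontal (vertical) sides of the cells; its edges are the segments in the skeleton that join two neighbouring vertices. A T-junction is an interior vertex (one in $(1,m)\times(1,n)$) at which one of the four edges is missing. The horizontal extension of a T-junction with a missing horizontal edge is the closed segment obtained by moving horizontally in the direction of the missing edge until $\lfloor (p+1)/2\rfloor$ vertical edges or vertices are met, and in the opposite direction until $\lceil (p-1)/2\rceil$ of them are met; vertical extensions are defined likewise with $q$. The mesh is *analysis-suitable* if no horizontal extension meets a vertical one. With the active region $\mathsf{AR}=[1+\lfloor\frac{p+1}2\rfloor,\,m-\lfloor\frac{p+1}2\rfloor]\times[1+\lfloor\frac{q+1}2\rfloor,\,n-\lfloor\frac{q+1}2\rfloor]$ and the frame region (the closure of the complement of $\mathsf{AR}$ in the index domain), the mesh is *admissible* if the skeleton contains the lines $\{i\}\times[1,n]$ for $1\le i\le 1+\lfloor\frac{p+1}2\rfloor$ and $m-\lfloor\frac{p+1}2\rfloor\le i\le m$, the lines $[1,m]\times\{j\}$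 for $1\le j\le 1+\lfloor\frac{q+1}2\rfloor$ and $n-\lfloor\frac{q+1}2\rfloor\le j\le n$, and there is no T-junction in the frame region. **ASTS.** An analysis-suitable T-spline (ASTS) consists of an admissible analysis-suitable T-mesh and open knot vectors $0=s_1=\dots=s_{p+1}<s_{p+2}\le\dots\le s_{m-p-1}<s_{m-p}=\dots=s_m=1$ and $0=t_1=\dots=t_{q+1}<t_{q+2}\le\dots\le t_{n-q-1}<t_{n-q}=\dots=t_n=1$ with $m\ge 2p+2$ and $n\ge 2q+2$, whose knots have multiplicity at most $p+1$ and $q+1$, respectively. Its anchors $A=a\times b$ are the vertices ($p,q$ odd), horizontal edges ($p$ even, $q$ odd), vertical edges ($p$ odd, $q$ even) or cells ($p,q$ even) contained in $\mathsf{AR}$. The horizontal local index vector $i_1<\dots<i_{p+2}$ of $A$ consists of $p+2$ successive elements of the set of all $i$ such that $\{i\}\times b$ lies in the vertical skeleton, with $\{i_{(p+3)/2}\}=a$ for $p$ odd and $(i_{p/2+1},i_{p/2+2})=a$ for $p$ even; the vertical one $j_1<\dots<j_{q+2}$ is defined likewise. The blending function of $A$ is $$N_A(s,t)=N[s_{i_1},\dots,s_{i_{p+2}}](s)\,N[t_{j_1},\dots,t_{j_{q+2}}](t),\qquad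 (s,t)\in\hat\Omega=[0,1]^2,$$ with the univariate B-splines given by the Cox–de Boor recursion (starting from indicator functions of half-open intervals $[x,y)$, with $0/0=0$). Let $\mathsf N$ be the set of all $N_A$; the ASTS space $\mathcal T$ is its span. **Lemma.** Let $\mathcal T^0\subseteq\mathcal T^1\subseteq\dots\subseteq\mathcal T^L$ be the nested spaces of ASTS of degrees $p,q$ with sets of blending functions $\mathsf N^0,\dots,\mathsf N^L$, and let $\hat\Omega^L\subseteq\dots\subseteq\hat\Omega^0\subseteq\hat\Omega$ be nested sets. Put $\mathsf H^0=\mathsf N^0$ and, for $0\le\alpha<L$, $$\mathsf H^{\alpha+1}=\{N\in\mathsf H^\alpha:\operatorname{supp}N\nsubseteq\hat\Omega^{\alpha+1}\}\cup\{N\in\mathsf N^{\alpha+1}:\operatorname{supp}N\subseteq\hat\Omega^{\alpha+1}\},$$ where $\operatorname{supp}N$ is the closed support of $N$ in $\hat\Omega$. Then the functions in the hierarchical basis $\mathsf H=\mathsf H^L$ are linearly independent. -/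

import Mathlib

open scoped unitInterval

/-- The closed box `[left, right] × [bottom, top]` with integer corners in index space.  It is allowed
to degenerate to a segment or to a point. -/
structure Box where
  left : ℕ
  right : ℕ
  bottom : ℕ
  top : ℕ

/-- A T-mesh: a partition of the index domain `[1, m] × [1, n]` into rectangles with integer corners.
The cells are recorded through their closures; they are nondegenerate, they lie in the index domain,
and every unit square `[i, i + 1] × [j, j + 1]` of the index domain lies in exactly one of them. -/
structure TMesh where
  m : ℕ
  n : ℕ
  cells : Set Box
  cells_valid : ∀ C ∈ cells, 1 ≤ C.left ∧ C.left < C.right ∧ C.right ≤ m ∧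
    1 ≤ C.bottom ∧ C.bottom < C.top ∧ C.top ≤ n
  cells_partition : ∀ i j : ℕ, 1 ≤ i → i < m → 1 ≤ j → j < n →
    ∃! C : Box, C ∈ cells ∧ C.left ≤ i ∧ i < C.right ∧ C.bottom ≤ j ∧ j < C.top

namespace TMesh

/-- The vertices of a T-mesh are the corners of its cells. -/
def IsVertex (M : TMesh) (i j : ℕ) : Prop :=
  ∃ C ∈ M.cells, (i = C.left ∨ i = C.right) ∧ (j = C.bottom ∨ j = C.top)

/-- The horizontal skeleton: the union of all (closed) horizontal sides of cells, that is, of all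
horizontal edges with their end points. -/
def hSkeleton (M : TMesh) : Set (ℝ × ℝ) :=
  {x | ∃ C ∈ M.cells, (x.2 = C.bottom ∨ x.2 = C.top) ∧ (C.left : ℝ) ≤ x.1 ∧ x.1 ≤ C.right}

/-- The vertical skeleton: the union of all (closed) vertical sides of cells, that is, of all
vertical edges with their end points. -/
def vSkeleton (M : TMesh) : Set (ℝ × ℝ) :=
  {x | ∃ C ∈ M.cells, (x.1 = C.left ∨ x.1 = C.right) ∧ (C.bottom : ℝ) ≤ x.2 ∧ x.2 ≤ C.top}

/-- The segment `[i₁, i₂] × {j}` is contained in the horizontal skeleton. -/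
def HasHSegment (M : TMesh) (i₁ i₂ j : ℕ) : Prop :=
  Set.Icc (i₁ : ℝ) i₂ ×ˢ {(j : ℝ)} ⊆ M.hSkeleton

/-- The segment `{i} × [j₁, j₂]` is contained in the vertical skeleton. -/
def HasVSegment (M : TMesh) (i j₁ j₂ : ℕ) : Prop :=
  {(i : ℝ)} ×ˢ Set.Icc (j₁ : ℝ) j₂ ⊆ M.vSkeleton

/-- The horizontal indices seen from `[j₁, j₂]`: all `i` such that the vertical skeleton contains
`{i} × [j₁, j₂]`.  (For `j₁ < j₂` the open interval `(j₁, j₂)` gives the same set, as the skeleton is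
closed; for `j₁ = j₂ = j` these are the indices at which row `j` meets a vertical edge or vertex.) -/
def hIndices (M : TMesh) (j₁ j₂ : ℕ) : Set ℕ := {i | M.HasVSegment i j₁ j₂}

/-- The vertical indices seen from `[i₁, i₂]`: all `j` such that the horizontal skeleton contains
`[i₁, i₂] × {j}`. -/
def vIndices (M : TMesh) (i₁ i₂ : ℕ) : Set ℕ := {j | M.HasHSegment i₁ i₂ j}

/-- A vertex in the interior of the index domain. -/
def IsInteriorVertex (M : TMesh) (i j : ℕ) : Prop :=
  M.IsVertex i j ∧ 1 < i ∧ i < M.m ∧ 1 < j ∧ j < M.n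

/-- A T-junction with missing right edge (interior vertices have valence three or four, so an interior
vertex is a T-junction exactly when one of the four edges at it is missing). -/
def IsTJunctionRight (M : TMesh) (i j : ℕ) : Prop :=
  M.IsInteriorVertex i j ∧ ¬ M.HasHSegment i (i + 1) j

/-- A T-junction with missing left edge. -/
def IsTJunctionLeft (M : TMesh) (i j : ℕ) : Prop :=
  M.IsInteriorVertex i j ∧ ¬ M.HasHSegment (i - 1) i j

/-- A T-junction with missing upper edge. -/
def IsTJunctionUp (M : TMesh) (i j : ℕ) : Prop :=
  M.IsInteriorVertex i j ∧ ¬ M.HasVSegment i j (j + 1)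

/-- A T-junction with missing lower edge. -/
def IsTJunctionDown (M : TMesh) (i j : ℕ) : Prop :=
  M.IsInteriorVertex i j ∧ ¬ M.HasVSegment i (j - 1) j

/-- `[e₁, e₂] × {j}` is a horizontal T-junction extension, i.e. the union of the face extension and
the edge extension of a T-junction `(i, j)` with a missing horizontal edge.  The face extension goes in
the direction of the missing edge until `⌊(p + 1) / 2⌋` vertical edges or vertices are met, the edge
extension goes in the opposite direction until `⌈(p - 1) / 2⌉ = ⌊p / 2⌋` of them are met. -/
def IsHExtension (M : TMesh) (p : ℕ) (e₁ e₂ j : ℕ) : Prop :=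
  ∃ i, e₁ ≤ i ∧ i ≤ e₂ ∧ e₁ ∈ M.hIndices j j ∧ e₂ ∈ M.hIndices j j ∧
    ((M.IsTJunctionRight i j ∧ (M.hIndices j j ∩ Set.Ioc i e₂).ncard = (p + 1) / 2 ∧
        (M.hIndices j j ∩ Set.Ico e₁ i).ncard = p / 2) ∨
      (M.IsTJunctionLeft i j ∧ (M.hIndices j j ∩ Set.Ico e₁ i).ncard = (p + 1) / 2 ∧
        (M.hIndices j j ∩ Set.Ioc i e₂).ncard = p / 2))

/-- `{i} × [f₁, f₂]` is a vertical T-junction extension. -/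
def IsVExtension (M : TMesh) (q : ℕ) (i f₁ f₂ : ℕ) : Prop :=
  ∃ j, f₁ ≤ j ∧ j ≤ f₂ ∧ f₁ ∈ M.vIndices i i ∧ f₂ ∈ M.vIndices i i ∧
    ((M.IsTJunctionUp i j ∧ (M.vIndices i i ∩ Set.Ioc j f₂).ncard = (q + 1) / 2 ∧
        (M.vIndices i i ∩ Set.Ico f₁ j).ncard = q / 2) ∨
      (M.IsTJunctionDown i j ∧ (M.vIndices i i ∩ Set.Ico f₁ j).ncard = (q + 1) / 2 ∧
        (M.vIndices i i ∩ Set.Ioc j f₂).ncard = q / 2))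

/-- Analysis-suitability: no horizontal T-junction extension intersects a vertical one (both are closed
segments, so they may not share an end point either). -/
def IsAnalysisSuitable (M : TMesh) (p q : ℕ) : Prop :=
  ∀ e₁ e₂ j i f₁ f₂, M.IsHExtension p e₁ e₂ j → M.IsVExtension q i f₁ f₂ →
    ¬ (e₁ ≤ i ∧ i ≤ e₂ ∧ f₁ ≤ j ∧ j ≤ f₂)

/-- The box lies in the active region
`[1 + ⌊(p + 1) / 2⌋, m - ⌊(p + 1) / 2⌋] × [1 + ⌊(q + 1) / 2⌋, n - ⌊(q + 1) / 2⌋]`. -/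
def InActiveRegion (M : TMesh) (p q : ℕ) (A : Box) : Prop :=
  1 + (p + 1) / 2 ≤ A.left ∧ A.right + (p + 1) / 2 ≤ M.m ∧
    1 + (q + 1) / 2 ≤ A.bottom ∧ A.top + (q + 1) / 2 ≤ M.n

/-- The interior vertex `(i, j)` lies in the (closed) frame region, the closure of the complement of the
active region. -/
def InFrameRegion (M : TMesh) (p q : ℕ) (i j : ℕ) : Prop :=
  i ≤ 1 + (p + 1) / 2 ∨ M.m ≤ i + (p + 1) / 2 ∨ j ≤ 1 + (q + 1) / 2 ∨ M.n ≤ j + (q + 1) / 2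

/-- Admissibility: the skeleton contains all index lines in the frame region that run parallel to the
nearest side of the index domain, and there are no T-junctions in the frame region. -/
structure IsAdmissible (M : TMesh) (p q : ℕ) : Prop where
  vertical_lines : ∀ i, (1 ≤ i ∧ i ≤ 1 + (p + 1) / 2) ∨ (M.m ≤ i + (p + 1) / 2 ∧ i ≤ M.m) →
    M.HasVSegment i 1 M.n
  horizontal_lines : ∀ j, (1 ≤ j ∧ j ≤ 1 + (q + 1) / 2) ∨ (M.n ≤ j + (q + 1) / 2 ∧ j ≤ M.n) →
    M.HasHSegment 1 M.m j
  no_tjunction : ∀ i j, M.InFrameRegion p q i j →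
    ¬ M.IsTJunctionRight i j ∧ ¬ M.IsTJunctionLeft i j ∧
      ¬ M.IsTJunctionUp i j ∧ ¬ M.IsTJunctionDown i j

/-- `[i₁, i₂] × {j}` is a horizontal edge: it joins two neighbouring vertices and lies in the skeleton. -/
def IsHEdge (M : TMesh) (i₁ i₂ j : ℕ) : Prop :=
  i₁ < i₂ ∧ M.IsVertex i₁ j ∧ M.IsVertex i₂ j ∧ M.HasHSegment i₁ i₂ j ∧
    ∀ i, i₁ < i → i < i₂ → ¬ M.IsVertex i j

/-- `{i} × [j₁, j₂]` is a vertical edge. -/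
def IsVEdge (M : TMesh) (i j₁ j₂ : ℕ) : Prop :=
  j₁ < j₂ ∧ M.IsVertex i j₁ ∧ M.IsVertex i j₂ ∧ M.HasVSegment i j₁ j₂ ∧
    ∀ j, j₁ < j → j < j₂ → ¬ M.IsVertex i j

/-- The anchors (recorded through their closures): the vertices, horizontal edges, vertical edges or
cells in the active region, according to the parities of `p` and `q`. -/
def IsAnchor (M : TMesh) (p q : ℕ) (A : Box) : Prop :=
  M.InActiveRegion p q A ∧
    ((Odd p ∧ Odd q ∧ A.left = A.right ∧ A.bottom = A.top ∧ M.IsVertex A.left A.bottom) ∨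
     (Even p ∧ Odd q ∧ A.bottom = A.top ∧ M.IsHEdge A.left A.right A.bottom) ∨
     (Odd p ∧ Even q ∧ A.left = A.right ∧ M.IsVEdge A.left A.bottom A.top) ∨
     (Even p ∧ Even q ∧ A ∈ M.cells))

end TMesh

/-- `v 0 < ⋯ < v (p + 1)` is the local index vector of degree `p`, selected from the index set `S`, around
the anchor side with end points `a₁` and `a₂`: `p + 2` successive elements of `S` which for odd `p` have
`a₁ = a₂` as their middle entry, and for even `p` have `a₁, a₂` as their two middle entries.
(`Fin`-indexing starts from zero: the `k`-th entry of the vector is `v (k - 1)`.) -/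
structure IsLocalIndexVector (p : ℕ) (S : Set ℕ) (a₁ a₂ : ℕ) (v : Fin (p + 2) → ℕ) : Prop where
  strictMono : StrictMono v
  mem : ∀ k, v k ∈ S
  successive : ∀ i ∈ S, v 0 ≤ i → i ≤ v (Fin.last (p + 1)) → ∃ k, v k = i
  middle_left : ∀ k : Fin (p + 2), (k : ℕ) = (p + 1) / 2 → v k = a₁
  middle_right : ∀ k : Fin (p + 2), (k : ℕ) = p / 2 + 1 → v k = a₂

/-- The B-spline basis function `N[x 0, …, x (p + 1)]` of degree `p`, by the Cox–de Boor recursion.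
Quotients with denominator zero are zero, as usual. -/
noncomputable def bSpline : (p : ℕ) → (Fin (p + 2) → ℝ) → ℝ → ℝ
  | 0, x, s => Set.indicator (Set.Ico (x 0) (x 1)) 1 s
  | p + 1, x, s =>
    (s - x 0) / (x (Fin.last (p + 1)).castSucc - x 0) * bSpline p (fun k => x k.castSucc) s +
    (x (Fin.last (p + 2)) - s) / (x (Fin.last (p + 2)) - x 1) * bSpline p (fun k => x k.succ) s

/-- `s 1, …, s m` is an open knot vector of degree `p` on `[0, 1]`:
`0 = s 1 = ⋯ = s (p + 1) < s (p + 2) ≤ ⋯ ≤ s (m - p - 1) < s (m - p) = ⋯ = s m = 1`,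
with all multiplicities at most `p + 1`.  The values of `s` outside `1, …, m` are irrelevant. -/
structure IsOpenKnotVector (p m : ℕ) (s : ℕ → ℝ) : Prop where
  length : 2 * p + 2 ≤ m
  monotone : MonotoneOn s (Set.Icc 1 m)
  first : ∀ i, 1 ≤ i → i ≤ p + 1 → s i = 0
  last : ∀ i, m ≤ i + p → i ≤ m → s i = 1
  interior : ∀ i, p + 1 < i → i + p < m → 0 < s i ∧ s i < 1
  multiplicity : ∀ i, 1 ≤ i → i + (p + 1) ≤ m → s i < s (i + (p + 1))

/-- The data of an analysis-suitable T-spline (ASTS) of degrees `p, q`: an admissible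
analysis-suitable T-mesh with a horizontal and a vertical open knot vector. -/
structure ASTS (p q : ℕ) where
  mesh : TMesh
  hKnot : ℕ → ℝ
  vKnot : ℕ → ℝ
  admissible : mesh.IsAdmissible p q
  analysisSuitable : mesh.IsAnalysisSuitable p q
  hKnot_open : IsOpenKnotVector p mesh.m hKnot
  vKnot_open : IsOpenKnotVector q mesh.n vKnot

namespace ASTS

variable {p q : ℕ}

/-- The T-spline blending function on the parametric domain `[0, 1] × [0, 1]` with local index
vectors `v` and `w`. -/
noncomputable def blending (T : ASTS p q) (v : Fin (p + 2) → ℕ) (w : Fin (q + 2) → ℕ) :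
    I × I → ℝ :=
  fun x => bSpline p (fun k => T.hKnot (v k)) x.1 * bSpline q (fun k => T.vKnot (w k)) x.2

/-- The set of all blending functions `N_A`, where `A` runs over the anchors. -/
def basis (T : ASTS p q) : Set (I × I → ℝ) :=
  {f | ∃ A v w, T.mesh.IsAnchor p q A ∧
    IsLocalIndexVector p (T.mesh.hIndices A.bottom A.top) A.left A.right v ∧
    IsLocalIndexVector q (T.mesh.vIndices A.left A.right) A.bottom A.top w ∧
    f = T.blending v w}

/-- The ASTS space: the span of the blending functions. -/
def space (T : ASTS p q) : Submodule ℝ (I × I → ℝ) := Submodule.span ℝ T.basis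

end ASTS

/-- The hierarchical basis: at level `0` it consists of all blending functions of `T 0`; in passing to
level `α + 1`, the functions whose support is not contained in `Ω (α + 1)` are kept, and the blending
functions of `T (α + 1)` whose support is contained in `Ω (α + 1)` are added.  Supports are closed. -/
def hierarchicalBasis {p q : ℕ} (T : ℕ → ASTS p q) (Ω : ℕ → Set (I × I)) : ℕ → Set (I × I → ℝ)
  | 0 => (T 0).basis
  | α + 1 =>
    {f ∈ hierarchicalBasis T Ω α | ¬ tsupport f ⊆ Ω (α + 1)} ∪
      {f ∈ (T (α + 1)).basis | tsupport f ⊆ Ω (α + 1)}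

/-! The proof is Kraft's argument for hierarchical B-splines, and it needs one property of each
level: local linear independence. In a vanishing combination, treat the levels from coarse to fine.
Let `f` have level `α`, and let `U` be the open set of points outside the supports of all functions
of finer level that occur. Finer supports lie in `Ω (α + 1)` and the support of `f` does not, so `f`
does not vanish identically on `U`. On `U` the finer functions vanish, and the coarser ones already
have coefficient zero. Hence a combination of blending functions of one level vanishes on `U`, and
local linear independence gives `c f = 0`.

Local linear independence (`ASTS.coeff_eq_zero_of_sum_eq_zero`) rests on de Boor's dual functionals.
Immediately to the upper right of a point where `f` is nonzero, every blending function of the level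
is a product of two univariate polynomials. The functional belonging to an index vector `v` takes
the value 1 on the piece of its own B-spline and 0 on that of `v' ≠ v`, provided that `v` and `v'`
overlap, i.e. can be read off from one common knot sequence (`dualFunctional_bSplinePiece`, from
Marsden's identity). So the product of the two functionals of `f` isolates the coefficient of `f`
once any two different pairs of index vectors overlap and differ in one and the same direction.

This is dual compatibility (`TMesh.IsIndexedAnchor.overlap_or_overlap`), and here
analysis-suitability enters. If the index vectors of two anchors overlap in neither direction, there
are an index `i` and an index `j`, each in the common range, and each seen by only one of the
anchors. On column `i` the skeleton then ends between `(i, j)` and one of the anchors, in a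
T-junction; the same happens on row `j`. Counting stations shows that `(i, j)` lies on a vertical
and on a horizontal extension (`TMesh.IsIndexedAnchor.reaches`), which is excluded. -/

/-! ### T-junction extensions on a single line -/

/-- The one-dimensional content of the definition of T-junction extensions: `S` is the set of stations
on the line, `R` and `L` single out the T-junctions with missing edge in positive and negative
direction. -/
def IsLineExtension (p : ℕ) (S : Set ℕ) (R L : ℕ → Prop) (e₁ e₂ : ℕ) : Prop :=
  ∃ i, e₁ ≤ i ∧ i ≤ e₂ ∧ e₁ ∈ S ∧ e₂ ∈ S ∧
    ((R i ∧ (S ∩ Set.Ioc i e₂).ncard = (p + 1) / 2 ∧ (S ∩ Set.Ico e₁ i).ncard = p / 2) ∨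
      (L i ∧ (S ∩ Set.Ico e₁ i).ncard = (p + 1) / 2 ∧ (S ∩ Set.Ioc i e₂).ncard = p / 2))

/-- The station `i` lies in some extension. -/
def IsReached (p : ℕ) (S : Set ℕ) (R L : ℕ → Prop) (i : ℕ) : Prop :=
  ∃ e₁ e₂, IsLineExtension p S R L e₁ e₂ ∧ e₁ ≤ i ∧ i ≤ e₂

/-- The T-junction `i'` lies between the anchor side `[a₁, a₂]` and the station `i`. -/
def IsBetween (R L : ℕ → Prop) (a₁ a₂ i i' : ℕ) : Prop :=
  (R i' ∨ L i') ∧ ((i' ≤ i ∧ (a₁ < i' ∨ (R i' ∧ a₂ ≤ i'))) ∨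
    (i ≤ i' ∧ (i' < a₂ ∨ (L i' ∧ i' ≤ a₁))))

/-- Around every T-junction there are enough stations for the extensions of degree `p` to exist. -/
structure HasStations (p : ℕ) (S : Set ℕ) (R L : ℕ → Prop) : Prop where
  mem : ∀ i, R i ∨ L i → i ∈ S
  right : ∀ i, R i ∨ L i → ∀ k ≤ (p + 1) / 2, ∃ e ∈ S, i ≤ e ∧ (S ∩ Set.Ioc i e).ncard = k
  left : ∀ i, R i ∨ L i → ∀ k ≤ (p + 1) / 2, ∃ e ∈ S, e ≤ i ∧ (S ∩ Set.Ico e i).ncard = k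

namespace IsLocalIndexVector

variable {p : ℕ} {S : Set ℕ} {a₁ a₂ : ℕ} {v : Fin (p + 2) → ℕ}

lemma le_last (hv : IsLocalIndexVector p S a₁ a₂ v) (k : Fin (p + 2)) : v k ≤ v (Fin.last (p + 1)) :=
  hv.strictMono.monotone (Fin.le_last k)

lemma zero_le (hv : IsLocalIndexVector p S a₁ a₂ v) (k : Fin (p + 2)) : v 0 ≤ v k :=
  hv.strictMono.monotone (Fin.zero_le k)

lemma apply_left (hv : IsLocalIndexVector p S a₁ a₂ v) :
    v ⟨(p + 1) / 2, by omega⟩ = a₁ := hv.middle_left _ rfl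

lemma apply_right (hv : IsLocalIndexVector p S a₁ a₂ v) :
    v ⟨p / 2 + 1, by omega⟩ = a₂ := hv.middle_right _ rfl

lemma left_mem (hv : IsLocalIndexVector p S a₁ a₂ v) : a₁ ∈ S := hv.apply_left ▸ hv.mem _

lemma right_mem (hv : IsLocalIndexVector p S a₁ a₂ v) : a₂ ∈ S := hv.apply_right ▸ hv.mem _

lemma left_le_right (hv : IsLocalIndexVector p S a₁ a₂ v) : a₁ ≤ a₂ := by
  rw [← hv.apply_left, ← hv.apply_right]
  exact hv.strictMono.monotone (Fin.mk_le_mk.2 (by omega))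

lemma zero_le_left (hv : IsLocalIndexVector p S a₁ a₂ v) : v 0 ≤ a₁ := hv.apply_left ▸ hv.zero_le _

lemma right_le_last (hv : IsLocalIndexVector p S a₁ a₂ v) : a₂ ≤ v (Fin.last (p + 1)) :=
  hv.apply_right ▸ hv.le_last _

/-- The two middle entries are neighbours in the index set. -/
lemma right_le_of_left_lt (hv : IsLocalIndexVector p S a₁ a₂ v) {i : ℕ} (hi : i ∈ S)
    (h : a₁ < i) : a₂ ≤ i := by
  by_contra! hlt
  obtain ⟨k, hk⟩ := hv.successive i hi (hv.zero_le_left.trans h.le) (hlt.le.trans hv.right_le_last)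
  rw [← hk, ← hv.apply_left, hv.strictMono.lt_iff_lt] at h
  rw [← hk, ← hv.apply_right, hv.strictMono.lt_iff_lt] at hlt
  simp only [Fin.lt_def] at h hlt
  omega

lemma le_left_of_lt_right (hv : IsLocalIndexVector p S a₁ a₂ v) {i : ℕ} (hi : i ∈ S)
    (h : i < a₂) : i ≤ a₁ := by
  by_contra! hlt
  have := hv.right_le_of_left_lt hi hlt
  omega

end IsLocalIndexVector

section Line

variable {p : ℕ} {S S' : Set ℕ} {R L : ℕ → Prop} {a₁ a₂ : ℕ} {v : Fin (p + 2) → ℕ}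

/-- The extension of `i'` cannot stop before `i`, because `v` has too few entries there. If it
stopped at `e < i`, all stations in `(i', e]` would be entries of `v` strictly between `i' = v k`
and the last entry, so at most `p - k`. With the missing edge on the right the extension counts `(p
+ 1) / 2` stations, while `k ≥ p / 2 + 1`. Otherwise it counts `p / 2`, but then `i'` lies strictly
beyond `a₁`, so `k > (p + 1) / 2`. Either way the count is impossible. -/
lemma isReached_of_isBetween_right (hS : HasStations p S R L) (hv : IsLocalIndexVector p S' a₁ a₂ v)
    {i i' : ℕ} (hi' : R i' ∨ L i') (hle : i' ≤ i) (hb : a₁ < i' ∨ (R i' ∧ a₂ ≤ i'))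
    (hi : i ≤ v (Fin.last (p + 1))) (hsub : ∀ k ∈ S, i' ≤ k → k < i → k ∈ S') :
    IsReached p S R L i := by
  have key : ∀ N, (L i' → ¬ R i' → N = p / 2) → (R i' → N = (p + 1) / 2) →
      ∀ e, i' ≤ e → (S ∩ Set.Ioc i' e).ncard = N → i ≤ e := by
    intro N hN₁ hN₂ e hie he
    rcases hle.eq_or_lt with rfl | hlt
    · exact hie
    by_contra! hei
    have hmem : i' ∈ S' := hsub i' (hS.mem _ hi') le_rfl hlt
    have h₁ : a₁ ≤ i' := by
      rcases hb with h | h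
      exacts [h.le, hv.left_le_right.trans h.2]
    have h₂ : a₂ ≤ i' := by
      rcases hb with h | h
      exacts [hv.right_le_of_left_lt hmem h, h.2]
    obtain ⟨k, hk⟩ := hv.successive i' hmem (hv.zero_le_left.trans h₁) (hle.trans hi)
    have hsubset : S ∩ Set.Ioc i' e ⊆ ((Finset.Ioo k (Fin.last (p + 1))).image v : Finset ℕ) := by
      rintro x ⟨hxS, hx₁, hx₂⟩
      have hx : x ∈ S' := hsub x hxS hx₁.le (hx₂.trans_lt hei)
      obtain ⟨l, hl⟩ := hv.successive x hx ((hv.zero_le_left.trans h₁).trans hx₁.le)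
        ((hx₂.trans hei.le).trans hi)
      simp only [Finset.coe_image, Finset.coe_Ioo, Set.mem_image, Set.mem_Ioo]
      refine ⟨l, ⟨?_, ?_⟩, hl⟩
      · rw [← hv.strictMono.lt_iff_lt, hk, hl]; exact hx₁
      · rw [← hv.strictMono.lt_iff_lt, hl]; exact (hx₂.trans_lt hei).trans_le hi
    have hcard := (Set.ncard_le_ncard hsubset (Finset.finite_toSet _)).trans
      ((Set.ncard_coe_finset _).trans_le Finset.card_image_le)
    rw [he, Fin.card_Ioo, Fin.val_last] at hcard
    have hk₂ : p / 2 + 1 ≤ k.1 := by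
      rw [← hk, ← hv.apply_right, hv.strictMono.le_iff_le, Fin.le_def] at h₂; exact h₂
    have hkp : k.1 < p + 1 := by
      have : v k < v (Fin.last (p + 1)) := by rw [hk]; omega
      rw [hv.strictMono.lt_iff_lt, Fin.lt_def] at this
      exact this
    by_cases hR : R i'
    · have := hN₂ hR; omega
    · have hN := hN₁ (hi'.resolve_left hR) hR
      have h₃ : a₁ < i' := hb.resolve_right fun h => hR h.1
      rw [← hk, ← hv.apply_left, hv.strictMono.lt_iff_lt, Fin.lt_def] at h₃
      simp only at h₃
      omega
  by_cases hR : R i'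
  · obtain ⟨e₂, he₂, h₂, hc₂⟩ := hS.right i' hi' ((p + 1) / 2) le_rfl
    obtain ⟨e₁, he₁, h₁, hc₁⟩ := hS.left i' hi' (p / 2) (by omega)
    exact ⟨e₁, e₂, ⟨i', h₁, h₂, he₁, he₂, .inl ⟨hR, hc₂, hc₁⟩⟩, h₁.trans hle,
      key _ (fun _ h => absurd hR h) (fun _ => rfl) e₂ h₂ hc₂⟩
  · obtain ⟨e₂, he₂, h₂, hc₂⟩ := hS.right i' hi' (p / 2) (by omega)
    obtain ⟨e₁, he₁, h₁, hc₁⟩ := hS.left i' hi' ((p + 1) / 2) le_rfl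
    exact ⟨e₁, e₂, ⟨i', h₁, h₂, he₁, he₂, .inr ⟨hi'.resolve_left hR, hc₁, hc₂⟩⟩, h₁.trans hle,
      key _ (fun _ _ => rfl) (fun h => absurd h hR) e₂ h₂ hc₂⟩

lemma isReached_of_isBetween_left (hS : HasStations p S R L) (hv : IsLocalIndexVector p S' a₁ a₂ v)
    {i i' : ℕ} (hi' : R i' ∨ L i') (hle : i ≤ i') (hb : i' < a₂ ∨ (L i' ∧ i' ≤ a₁))
    (hi : v 0 ≤ i) (hsub : ∀ k ∈ S, i < k → k ≤ i' → k ∈ S') :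
    IsReached p S R L i := by
  have key : ∀ N, (R i' → ¬ L i' → N = p / 2) → (L i' → N = (p + 1) / 2) →
      ∀ e, e ≤ i' → (S ∩ Set.Ico e i').ncard = N → e ≤ i := by
    intro N hN₁ hN₂ e hie he
    rcases hle.eq_or_lt with rfl | hlt
    · exact hie
    by_contra! hei
    have hmem : i' ∈ S' := hsub i' (hS.mem _ hi') hlt le_rfl
    have h₁ : i' ≤ a₂ := by
      rcases hb with h | h
      exacts [h.le, h.2.trans hv.left_le_right]
    have h₂ : i' ≤ a₁ := by
      rcases hb with h | h
      exacts [hv.le_left_of_lt_right hmem h, h.2]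
    obtain ⟨k, hk⟩ := hv.successive i' hmem (hi.trans hle) (h₁.trans hv.right_le_last)
    have hsubset : S ∩ Set.Ico e i' ⊆ ((Finset.Ioo 0 k).image v : Finset ℕ) := by
      rintro x ⟨hxS, hx₁, hx₂⟩
      have hx : x ∈ S' := hsub x hxS (hei.trans_le hx₁) hx₂.le
      obtain ⟨l, hl⟩ := hv.successive x hx (hi.trans (hei.le.trans hx₁))
        (hx₂.le.trans (h₁.trans hv.right_le_last))
      simp only [Finset.coe_image, Finset.coe_Ioo, Set.mem_image, Set.mem_Ioo]
      refine ⟨l, ⟨?_, ?_⟩, hl⟩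
      · rw [← hv.strictMono.lt_iff_lt, hl]; exact hi.trans_lt (hei.trans_le hx₁)
      · rw [← hv.strictMono.lt_iff_lt, hl, hk]; exact hx₂
    have hcard := (Set.ncard_le_ncard hsubset (Finset.finite_toSet _)).trans
      ((Set.ncard_coe_finset _).trans_le Finset.card_image_le)
    rw [he, Fin.card_Ioo, Fin.val_zero] at hcard
    have hk₂ : k.1 ≤ (p + 1) / 2 := by
      rw [← hk, ← hv.apply_left, hv.strictMono.le_iff_le, Fin.le_def] at h₂; exact h₂
    have hkp : 0 < k.1 := by
      have : v 0 < v k := by rw [hk]; omega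
      rw [hv.strictMono.lt_iff_lt, Fin.lt_def] at this
      exact this
    by_cases hL : L i'
    · have := hN₂ hL; omega
    · have hN := hN₁ (hi'.resolve_right hL) hL
      have h₃ : i' < a₂ := hb.resolve_right fun h => hL h.1
      rw [← hk, ← hv.apply_right, hv.strictMono.lt_iff_lt, Fin.lt_def] at h₃
      simp only at h₃
      omega
  by_cases hL : L i'
  · obtain ⟨e₂, he₂, h₂, hc₂⟩ := hS.right i' hi' (p / 2) (by omega)
    obtain ⟨e₁, he₁, h₁, hc₁⟩ := hS.left i' hi' ((p + 1) / 2) le_rfl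
    exact ⟨e₁, e₂, ⟨i', h₁, h₂, he₁, he₂, .inr ⟨hL, hc₁, hc₂⟩⟩,
      key _ (fun _ h => absurd hL h) (fun _ => rfl) e₁ h₁ hc₁, hle.trans h₂⟩
  · obtain ⟨e₂, he₂, h₂, hc₂⟩ := hS.right i' hi' ((p + 1) / 2) le_rfl
    obtain ⟨e₁, he₁, h₁, hc₁⟩ := hS.left i' hi' (p / 2) (by omega)
    exact ⟨e₁, e₂, ⟨i', h₁, h₂, he₁, he₂, .inl ⟨hi'.resolve_right hL, hc₂, hc₁⟩⟩,
      key _ (fun _ _ => rfl) (fun h => absurd h hL) e₁ h₁ hc₁, hle.trans h₂⟩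

/-- If a T-junction lies between an anchor side and the station `i`, then `i` is reached by its
extension, or a reached station closer to the anchor is missing from the index set of the anchor. -/
lemma IsBetween.isReached_or (hS : HasStations p S R L) (hv : IsLocalIndexVector p S' a₁ a₂ v)
    {i i' : ℕ} (h : IsBetween R L a₁ a₂ i i') (hi₀ : v 0 ≤ i) (hi₁ : i ≤ v (Fin.last (p + 1))) :
    IsReached p S R L i ∨ ∃ k ∈ S, k ∉ S' ∧ IsReached p S R L k ∧ v 0 ≤ k ∧
      k ≤ v (Fin.last (p + 1)) ∧ ((k < i ∧ a₁ < k) ∨ (i < k ∧ k < a₂)) := by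
  classical
  obtain ⟨hi', ⟨hle, hb⟩ | ⟨hle, hb⟩⟩ := h
  · by_cases hsub : ∀ k ∈ S, i' ≤ k → k < i → k ∈ S'
    · exact .inl (isReached_of_isBetween_right hS hv hi' hle hb hi₁ hsub)
    right
    push Not at hsub
    -- For the smallest missing station `k`, no station in `[i', k)` is missing, so the previous
    -- counting applies with `k` in place of `i`.
    obtain ⟨hkS, hik, hki, hkS'⟩ := Nat.find_spec hsub
    have hmin := fun k => Nat.find_min hsub (m := k)
    generalize Nat.find hsub = k at *
    have hak : a₁ < k := by
      rcases hb with h | h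
      · omega
      · have := hv.left_le_right
        refine lt_of_le_of_ne (by omega) ?_
        rintro rfl
        exact hkS' hv.left_mem
    refine ⟨k, hkS, hkS', isReached_of_isBetween_right hS hv hi' hik hb (hki.le.trans hi₁) ?_,
      hv.zero_le_left.trans hak.le, hki.le.trans hi₁, .inl ⟨hki, hak⟩⟩
    intro x hx h₁ h₂
    by_contra h₃
    exact hmin x h₂ ⟨hx, h₁, h₂.trans hki, h₃⟩
  · by_cases hsub : ∀ k ∈ S, i < k → k ≤ i' → k ∈ S'
    · exact .inl (isReached_of_isBetween_left hS hv hi' hle hb hi₀ hsub)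
    right
    push Not at hsub
    -- Minimising the distance `d` to `i'` selects the largest missing station, the one nearest to
    -- the anchor.
    have hex : ∃ d, ∃ k ∈ S, i < k ∧ k + d = i' ∧ k ∉ S' := by
      obtain ⟨k, h₁, h₂, h₃, h₄⟩ := hsub
      exact ⟨i' - k, k, h₁, h₂, by omega, h₄⟩
    obtain ⟨k, hkS, hik, hki, hkS'⟩ := Nat.find_spec hex
    have hmin := fun d => Nat.find_min hex (m := d)
    generalize Nat.find hex = d at *
    have hak : k < a₂ := by
      rcases hb with h | h
      · omega
      · have := hv.left_le_right
        refine lt_of_le_of_ne (by omega) ?_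
        rintro rfl
        exact hkS' hv.right_mem
    refine ⟨k, hkS, hkS', isReached_of_isBetween_left hS hv hi' (by omega) hb (hi₀.trans hik.le) ?_,
      hi₀.trans hik.le, hak.le.trans hv.right_le_last, .inr ⟨hik, hak⟩⟩
    intro x hx h₁ h₂
    by_contra h₃
    exact hmin (i' - x) (by omega) ⟨x, hx, by omega, by omega, h₃⟩

/-! ### Ends of covered segments, and counting of stations -/

/-- The segment `[b₁, b₂]`, possibly a point, is covered by the unit segments `[l, l + 1]` with `u l`. -/
def IsCovered (u : ℕ → Prop) (b₁ b₂ : ℕ) : Prop :=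
  (b₁ < b₂ → ∀ l, b₁ ≤ l → l < b₂ → u l) ∧ (b₁ = b₂ → u (b₁ - 1) ∨ u b₁)

/-- On a line whose unit segments are described by `u`, all ends of segments inside `[1, n]` are
T-junctions. -/
structure EndsAreTJunctions (n : ℕ) (u R L : ℕ → Prop) : Prop where
  range : ∀ l, u l → 1 ≤ l ∧ l < n
  right : ∀ l, 1 < l → l < n → u (l - 1) → ¬ u l → R l
  left : ∀ l, 1 < l → l < n → ¬ u (l - 1) → u l → L l

variable {n : ℕ} {u : ℕ → Prop}

lemma EndsAreTJunctions.exists_left (hu : EndsAreTJunctions n u R L) {x y : ℕ} (hx : 1 ≤ x)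
    (hxy : x < y) (h₁ : ¬ u x) (h₂ : u y) : ∃ l, x < l ∧ l ≤ y ∧ L l := by
  induction y, hxy using Nat.le_induction with
  | base => exact ⟨x + 1, by omega, le_rfl, hu.left _ (by omega) (hu.range _ h₂).2 (by simpa) h₂⟩
  | succ y hy ih =>
    by_cases h : u y
    · obtain ⟨l, h₁, h₂, h₃⟩ := ih h
      exact ⟨l, h₁, by omega, h₃⟩
    · exact ⟨y + 1, by omega, le_rfl, hu.left _ (by omega) (hu.range _ h₂).2 (by simpa) h₂⟩

lemma EndsAreTJunctions.exists_right (hu : EndsAreTJunctions n u R L) {x y : ℕ} (hy : y < n)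
    (hxy : x < y) (h₁ : u x) (h₂ : ¬ u y) : ∃ l, x < l ∧ l ≤ y ∧ R l := by
  have hx := (hu.range _ h₁).1
  induction y, hxy using Nat.le_induction with
  | base => exact ⟨x + 1, by omega, le_rfl, hu.right _ (by omega) hy (by simpa) h₂⟩
  | succ y hy' ih =>
    by_cases h : u y
    · exact ⟨y + 1, by omega, le_rfl, hu.right _ (by omega) hy (by simpa) h₂⟩
    · obtain ⟨l, h₁, h₂, h₃⟩ := ih (by omega) h
      exact ⟨l, h₁, by omega, h₃⟩

/-- On the way from an uncovered unit segment at the anchor side to a covered one at `j`, a covered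
segment must begin. Its end is a T-junction whose missing edge faces the anchor. -/
lemma EndsAreTJunctions.exists_isBetween (hu : EndsAreTJunctions n u R L) {b₁ b₂ j : ℕ}
    (hb : b₁ ≤ b₂) (hb₁ : 1 ≤ b₁) (hb₂ : b₂ ≤ n) (h : ¬ IsCovered u b₁ b₂) (hj : IsCovered u j j) :
    ∃ l, IsBetween R L b₁ b₂ j l := by
  have hj' := hj.2 rfl
  rcases hb.lt_or_eq with hlt | rfl
  · obtain ⟨x, h₁, h₂, hx⟩ : ∃ x, b₁ ≤ x ∧ x < b₂ ∧ ¬ u x := by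
      by_contra! hcon
      exact h ⟨fun _ => hcon, fun h => absurd h hlt.ne⟩
    rcases lt_or_ge x j with hxj | hxj
    · obtain ⟨y, hxy, hyj, hy⟩ : ∃ y, x < y ∧ y ≤ j ∧ u y := by
        rcases hj' with hj' | hj'
        · refine ⟨j - 1, lt_of_le_of_ne (by omega) ?_, by omega, hj'⟩
          rintro rfl
          exact hx hj'
        · exact ⟨j, hxj, le_rfl, hj'⟩
      obtain ⟨l, hl₁, hl₂, hl⟩ := hu.exists_left (by omega) hxy hx hy
      exact ⟨l, .inr hl, .inl ⟨by omega, .inl (by omega)⟩⟩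
    · obtain ⟨y, hjy, hyx, hy⟩ : ∃ y, j ≤ y + 1 ∧ y < x ∧ u y := by
        rcases hj' with hj' | hj'
        · refine ⟨j - 1, by omega, lt_of_le_of_ne (by omega) ?_, hj'⟩
          rintro rfl
          exact hx hj'
        · refine ⟨j, by omega, lt_of_le_of_ne (by omega) ?_, hj'⟩
          rintro rfl
          exact hx hj'
      obtain ⟨l, hl₁, hl₂, hl⟩ := hu.exists_right (by omega) hyx hy hx
      exact ⟨l, .inl hl, .inr ⟨by omega, .inl (by omega)⟩⟩
  · have hn : ¬ u (b₁ - 1) ∧ ¬ u b₁ := by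
      by_contra hcon
      exact h ⟨fun h => absurd h (lt_irrefl _), fun _ => by tauto⟩
    rcases lt_trichotomy b₁ j with hbj | rfl | hbj
    · obtain ⟨y, hxy, hyj, hy⟩ : ∃ y, b₁ < y ∧ y ≤ j ∧ u y := by
        rcases hj' with hj' | hj'
        · refine ⟨j - 1, lt_of_le_of_ne (by omega) ?_, by omega, hj'⟩
          intro h
          exact hn.2 (h ▸ hj')
        · exact ⟨j, hbj, le_rfl, hj'⟩
      obtain ⟨l, hl₁, hl₂, hl⟩ := hu.exists_left hb₁ hxy hn.2 hy
      exact ⟨l, .inr hl, .inl ⟨by omega, .inl (by omega)⟩⟩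
    · tauto
    · obtain ⟨y, hjy, hyx, hy⟩ : ∃ y, j ≤ y + 1 ∧ y < b₁ - 1 ∧ u y := by
        rcases hj' with hj' | hj'
        · have := (hu.range _ hj').1
          exact ⟨j - 1, by omega, by omega, hj'⟩
        · refine ⟨j, by omega, lt_of_le_of_ne (by omega) ?_, hj'⟩
          intro h
          exact hn.1 (h ▸ hj')
      obtain ⟨l, hl₁, hl₂, hl⟩ := hu.exists_right (by omega) hyx hy hn.1
      exact ⟨l, .inl hl, .inr ⟨by omega, .inl (by omega)⟩⟩

/-- Here the covered segment starts at the anchor and ends before `j`, so the missing edge faces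
`j`. This is the case for which `IsBetween` admits T-junctions at the end point of the side nearest
to `j`. -/
lemma EndsAreTJunctions.exists_isBetween' (hu : EndsAreTJunctions n u R L) {b₁ b₂ j : ℕ}
    (hb : b₁ ≤ b₂) (hj₁ : 1 ≤ j) (hj₂ : j ≤ n) (h : IsCovered u b₁ b₂) (hj : ¬ IsCovered u j j) :
    ∃ l, IsBetween R L b₁ b₂ j l := by
  have hn : ¬ u (j - 1) ∧ ¬ u j := by
    by_contra hcon
    exact hj ⟨fun h => absurd h (lt_irrefl _), fun _ => by tauto⟩
  have hcase : (∃ x, b₂ ≤ x + 1 ∧ x < j - 1 ∧ u x) ∨ (∃ y, j < y ∧ y ≤ b₁ ∧ u y) := by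
    rcases hb.lt_or_eq with hlt | rfl
    · have hc := h.1 hlt
      by_cases hjb : j ≤ b₁
      · refine .inr ⟨b₁, lt_of_le_of_ne hjb ?_, le_rfl, hc _ le_rfl hlt⟩
        rintro rfl
        exact hn.2 (hc _ le_rfl hlt)
      · refine .inl ⟨b₂ - 1, by omega, ?_, hc _ (by omega) (by omega)⟩
        by_contra hcon
        exact hn.1 (hc _ (by omega) (by omega))
    · have hne : b₁ ≠ j := by
        rintro rfl
        exact hj h
      rcases h.2 rfl with h' | h'
      · have := (hu.range _ h').1
        rcases hne.lt_or_gt with hlt | hlt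
        · exact .inl ⟨b₁ - 1, by omega, by omega, h'⟩
        · refine .inr ⟨b₁ - 1, lt_of_le_of_ne (by omega) ?_, by omega, h'⟩
          intro h
          exact hn.2 (h ▸ h')
      · rcases hne.lt_or_gt with hlt | hlt
        · refine .inl ⟨b₁, by omega, lt_of_le_of_ne (by omega) ?_, h'⟩
          intro h
          exact hn.1 (h ▸ h')
        · exact .inr ⟨b₁, hlt, le_rfl, h'⟩
  rcases hcase with ⟨x, h₁, h₂, h₃⟩ | ⟨y, h₁, h₂, h₃⟩
  · obtain ⟨l, hl₁, hl₂, hl⟩ := hu.exists_right (by omega) h₂ h₃ hn.1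
    exact ⟨l, .inl hl, .inl ⟨by omega, .inr ⟨hl, by omega⟩⟩⟩
  · obtain ⟨l, hl₁, hl₂, hl⟩ := hu.exists_left hj₁ h₁ hn.2 h₃
    exact ⟨l, .inr hl, .inr ⟨by omega, .inr ⟨hl, by omega⟩⟩⟩

/-- Stations in positive direction can be counted off one by one. -/
lemma exists_ncard_inter_Ioc {S : Set ℕ} {i N : ℕ} (hi : i ∈ S) :
    ∀ k, k ≤ (S ∩ Set.Ioc i N).ncard → ∃ e ∈ S, i ≤ e ∧ (S ∩ Set.Ioc i e).ncard = k := by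
  classical
  intro k
  induction k with
  | zero => exact fun _ => ⟨i, hi, le_rfl, by simp⟩
  | succ k ih =>
    intro hk
    obtain ⟨e, heS, hie, he⟩ := ih (by omega)
    have hex : ∃ x, x ∈ S ∧ e < x := by
      by_contra! hcon
      have : S ∩ Set.Ioc i N ⊆ S ∩ Set.Ioc i e := fun x hx => ⟨hx.1, hx.2.1, hcon x hx.1⟩
      have := Set.ncard_le_ncard this ((Set.finite_Ioc i e).inter_of_right S)
      omega
    obtain ⟨hxS, hex'⟩ := Nat.find_spec hex
    have hmin := fun d => Nat.find_min hex (m := d)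
    generalize Nat.find hex = x at *
    refine ⟨x, hxS, by omega, ?_⟩
    have : S ∩ Set.Ioc i x = insert x (S ∩ Set.Ioc i e) := by
      ext y
      simp only [Set.mem_inter_iff, Set.mem_Ioc, Set.mem_insert_iff]
      constructor
      · rintro ⟨h₁, h₂, h₃⟩
        rcases h₃.eq_or_lt with rfl | h₃
        · exact .inl rfl
        · refine .inr ⟨h₁, h₂, ?_⟩
          by_contra! h
          exact hmin y h₃ ⟨h₁, h⟩
      · rintro (rfl | ⟨h₁, h₂, h₃⟩)
        · exact ⟨hxS, by omega, le_rfl⟩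
        · exact ⟨h₁, h₂, by omega⟩
    rw [this, Set.ncard_insert_of_notMem _ ((Set.finite_Ioc i e).inter_of_right S), he]
    rintro ⟨-, -, h⟩
    omega

/-- Stations in negative direction can be counted off one by one. -/
lemma exists_ncard_inter_Ico {S : Set ℕ} {i : ℕ} (hi : i ∈ S) :
    ∀ k, k ≤ (S ∩ Set.Ico 0 i).ncard → ∃ e ∈ S, e ≤ i ∧ (S ∩ Set.Ico e i).ncard = k := by
  classical
  intro k
  induction k with
  | zero => exact fun _ => ⟨i, hi, le_rfl, by simp⟩
  | succ k ih =>
    intro hk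
    obtain ⟨e, heS, hie, he⟩ := ih (by omega)
    have hex : ∃ x, x ∈ S ∧ x < e := by
      by_contra! hcon
      have : S ∩ Set.Ico 0 i ⊆ S ∩ Set.Ico e i := fun x hx => ⟨hx.1, hcon x hx.1, hx.2.2⟩
      have := Set.ncard_le_ncard this ((Set.finite_Ico e i).inter_of_right S)
      omega
    obtain ⟨z, hz⟩ := hex
    obtain ⟨hxS, hex'⟩ := Nat.findGreatest_spec (P := fun x => x ∈ S ∧ x < e) hz.2.le hz
    have hmin := fun d => Nat.findGreatest_is_greatest (P := fun x => x ∈ S ∧ x < e) (n := e) (k := d)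
    generalize Nat.findGreatest (fun x => x ∈ S ∧ x < e) e = x at *
    refine ⟨x, hxS, by omega, ?_⟩
    have : S ∩ Set.Ico x i = insert x (S ∩ Set.Ico e i) := by
      ext y
      simp only [Set.mem_inter_iff, Set.mem_Ico, Set.mem_insert_iff]
      constructor
      · rintro ⟨h₁, h₂, h₃⟩
        rcases h₂.eq_or_lt with rfl | h₂
        · exact .inl rfl
        · refine .inr ⟨h₁, ?_, h₃⟩
          by_contra! h
          exact hmin y h₂ h.le ⟨h₁, h⟩
      · rintro (rfl | ⟨h₁, h₂, h₃⟩)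
        · exact ⟨hxS, le_rfl, by omega⟩
        · exact ⟨h₁, by omega, h₃⟩
    rw [this, Set.ncard_insert_of_notMem _ ((Set.finite_Ico e i).inter_of_right S), he]
    rintro ⟨-, h, -⟩
    omega

end Line

/-! ### From the mesh to rows and columns of unit segments -/

lemma forall_mem_Icc_iff_isCovered {P : ℕ → ℕ → Prop} (hP : ∀ a b, P a b → a < b) {j₁ j₂ : ℕ}
    (hj : j₁ ≤ j₂) :
    (∀ y ∈ Set.Icc (j₁ : ℝ) j₂, ∃ a b, P a b ∧ (a : ℝ) ≤ y ∧ y ≤ b) ↔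
      IsCovered (fun l => ∃ a b, P a b ∧ a ≤ l ∧ l + 1 ≤ b) j₁ j₂ := by
  constructor
  · intro h
    refine ⟨fun hlt l hl₁ hl₂ => ?_, ?_⟩
    · have h₁ : (j₁ : ℝ) ≤ l := by exact_mod_cast hl₁
      have h₂ : (l : ℝ) + 1 ≤ j₂ := by exact_mod_cast hl₂
      -- Sides have integer end points, so one that contains the midpoint contains the whole unit
      -- segment.
      obtain ⟨a, b, hab, ha, hb⟩ := h (l + 1 / 2) ⟨by linarith, by linarith⟩
      refine ⟨a, b, hab, ?_, ?_⟩
      · have : (a : ℝ) < (l + 1 : ℕ) := by push_cast; linarith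
        have : a < l + 1 := by exact_mod_cast this
        omega
      · have : (l : ℝ) < b := by linarith
        exact_mod_cast this
    · rintro rfl
      obtain ⟨a, b, hab, ha, hb⟩ := h j₁ ⟨le_rfl, le_rfl⟩
      have := hP a b hab
      have ha : a ≤ j₁ := by exact_mod_cast ha
      have hb : j₁ ≤ b := by exact_mod_cast hb
      rcases hb.lt_or_eq with hb | rfl
      · exact .inr ⟨a, b, hab, ha, hb⟩
      · exact .inl ⟨a, j₁, hab, by omega, by omega⟩
  · rintro ⟨h₁, h₂⟩ y ⟨hy₁, hy₂⟩
    rcases hj.lt_or_eq with hlt | rfl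
    · obtain ⟨l, hl₁, hl₂, hly, hyl⟩ : ∃ l : ℕ, j₁ ≤ l ∧ l < j₂ ∧ (l : ℝ) ≤ y ∧ y ≤ l + 1 := by
        have hy₀ : 0 ≤ y := (Nat.cast_nonneg _).trans hy₁
        rcases hy₂.lt_or_eq with hy₂ | rfl
        · exact ⟨⌊y⌋₊, Nat.le_floor hy₁, (Nat.floor_lt hy₀).2 hy₂, Nat.floor_le hy₀,
            (Nat.lt_floor_add_one y).le⟩
        · obtain ⟨d, rfl⟩ : ∃ d, j₂ = d + 1 := ⟨j₂ - 1, by omega⟩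
          exact ⟨d, by omega, by omega, by push_cast; linarith, by push_cast; linarith⟩
      obtain ⟨a, b, hab, ha, hb⟩ := h₁ hlt l hl₁ hl₂
      have ha : (a : ℝ) ≤ l := by exact_mod_cast ha
      have hb : (l : ℝ) + 1 ≤ b := by exact_mod_cast hb
      exact ⟨a, b, hab, ha.trans hly, hyl.trans hb⟩
    · obtain rfl := le_antisymm hy₁ hy₂
      rcases h₂ rfl with ⟨a, b, hab, ha, hb⟩ | ⟨a, b, hab, ha, hb⟩
      · exact ⟨a, b, hab, by exact_mod_cast (show a ≤ j₁ by omega),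
          by exact_mod_cast (show j₁ ≤ b by omega)⟩
      · exact ⟨a, b, hab, by exact_mod_cast (show a ≤ j₁ by omega),
          by exact_mod_cast (show j₁ ≤ b by omega)⟩

namespace TMesh

variable {M : TMesh} {p q : ℕ}

/-- The unit segment `[l, l + 1] × {j}` is contained in a side of a cell. -/
def HasHUnit (M : TMesh) (j l : ℕ) : Prop :=
  ∃ a b, (∃ C ∈ M.cells, (j = C.bottom ∨ j = C.top) ∧ a = C.left ∧ b = C.right) ∧ a ≤ l ∧ l + 1 ≤ b

/-- The unit segment `{i} × [l, l + 1]` is contained in a side of a cell. -/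
def HasVUnit (M : TMesh) (i l : ℕ) : Prop :=
  ∃ a b, (∃ C ∈ M.cells, (i = C.left ∨ i = C.right) ∧ a = C.bottom ∧ b = C.top) ∧ a ≤ l ∧ l + 1 ≤ b

lemma hasHSegment_iff {i₁ i₂ j : ℕ} (h : i₁ ≤ i₂) :
    M.HasHSegment i₁ i₂ j ↔ IsCovered (M.HasHUnit j) i₁ i₂ := by
  have := forall_mem_Icc_iff_isCovered
    (P := fun a b => ∃ C ∈ M.cells, (j = C.bottom ∨ j = C.top) ∧ a = C.left ∧ b = C.right)
    (by rintro _ _ ⟨C, hC, -, rfl, rfl⟩; exact (M.cells_valid C hC).2.1) h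
  refine Iff.trans ⟨fun hs y hy => ?_, fun hs => ?_⟩ this
  · obtain ⟨C, hC, h₁, h₂, h₃⟩ := hs (show (y, (j : ℝ)) ∈ _ from ⟨hy, rfl⟩)
    exact ⟨C.left, C.right, ⟨C, hC, h₁.imp (fun h => Nat.cast_injective (R := ℝ) h) (fun h => Nat.cast_injective (R := ℝ) h), rfl, rfl⟩, h₂, h₃⟩
  · rintro ⟨y, z⟩ ⟨hy, rfl : z = j⟩
    obtain ⟨_, _, ⟨C, hC, h₁, rfl, rfl⟩, h₂, h₃⟩ := hs y hy
    exact ⟨C, hC, h₁.imp (congrArg Nat.cast) (congrArg Nat.cast), h₂, h₃⟩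

lemma hasVSegment_iff {i j₁ j₂ : ℕ} (h : j₁ ≤ j₂) :
    M.HasVSegment i j₁ j₂ ↔ IsCovered (M.HasVUnit i) j₁ j₂ := by
  have := forall_mem_Icc_iff_isCovered
    (P := fun a b => ∃ C ∈ M.cells, (i = C.left ∨ i = C.right) ∧ a = C.bottom ∧ b = C.top)
    (by rintro _ _ ⟨C, hC, -, rfl, rfl⟩; exact (M.cells_valid C hC).2.2.2.2.1) h
  refine Iff.trans ⟨fun hs y hy => ?_, fun hs => ?_⟩ this
  · obtain ⟨C, hC, h₁, h₂, h₃⟩ := hs (show ((i : ℝ), y) ∈ _ from ⟨rfl, hy⟩)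
    exact ⟨C.bottom, C.top, ⟨C, hC, h₁.imp (fun h => Nat.cast_injective (R := ℝ) h) (fun h => Nat.cast_injective (R := ℝ) h), rfl, rfl⟩, h₂, h₃⟩
  · rintro ⟨z, y⟩ ⟨rfl : z = i, hy⟩
    obtain ⟨_, _, ⟨C, hC, h₁, rfl, rfl⟩, h₂, h₃⟩ := hs y hy
    exact ⟨C, hC, h₁.imp (congrArg Nat.cast) (congrArg Nat.cast), h₂, h₃⟩

lemma isCovered_unit {u : ℕ → Prop} {l : ℕ} : IsCovered u l (l + 1) ↔ u l := by
  refine ⟨fun h => h.1 (by omega) l le_rfl (by omega), fun h => ⟨fun _ k hk₁ hk₂ => ?_, by omega⟩⟩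
  obtain rfl : k = l := by omega
  exact h

lemma HasHUnit.bounds {j l : ℕ} (h : M.HasHUnit j l) : 1 ≤ l ∧ l < M.m ∧ 1 ≤ j ∧ j ≤ M.n := by
  obtain ⟨_, _, ⟨C, hC, h₁, rfl, rfl⟩, h₂, h₃⟩ := h
  have := M.cells_valid C hC
  omega

lemma HasVUnit.bounds {i l : ℕ} (h : M.HasVUnit i l) : 1 ≤ l ∧ l < M.n ∧ 1 ≤ i ∧ i ≤ M.m := by
  obtain ⟨_, _, ⟨C, hC, h₁, rfl, rfl⟩, h₂, h₃⟩ := h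
  have := M.cells_valid C hC
  omega

lemma IsCovered.exists_unit {u : ℕ → Prop} {b₁ b₂ : ℕ} (hb : b₁ ≤ b₂) (h : IsCovered u b₁ b₂) :
    ∃ l, u l := by
  rcases hb.lt_or_eq with hlt | rfl
  · exact ⟨b₁, h.1 hlt _ le_rfl hlt⟩
  · rcases h.2 rfl with h | h
    exacts [⟨_, h⟩, ⟨_, h⟩]

lemma mem_hIndices_bounds {i j₁ j₂ : ℕ} (hj : j₁ ≤ j₂) (h : i ∈ M.hIndices j₁ j₂) :
    1 ≤ i ∧ i ≤ M.m := by
  obtain ⟨l, hl⟩ := IsCovered.exists_unit hj ((hasVSegment_iff hj).1 h)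
  exact hl.bounds.2.2

lemma mem_vIndices_bounds {i₁ i₂ j : ℕ} (hi : i₁ ≤ i₂) (h : j ∈ M.vIndices i₁ i₂) :
    1 ≤ j ∧ j ≤ M.n := by
  obtain ⟨l, hl⟩ := IsCovered.exists_unit hi ((hasHSegment_iff hi).1 h)
  exact hl.bounds.2.2

lemma hasHUnit_of_first_or_last (hM : M.IsAdmissible p q) {j l : ℕ} (hj : j = 1 ∨ j = M.n)
    (hn : 1 ≤ M.n) (hl₁ : 1 ≤ l) (hl₂ : l < M.m) : M.HasHUnit j l :=
  ((hasHSegment_iff (by omega)).1 (hM.horizontal_lines j (by omega))).1 (by omega) l hl₁ hl₂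

lemma hasVUnit_of_first_or_last (hM : M.IsAdmissible p q) {i l : ℕ} (hi : i = 1 ∨ i = M.m)
    (hm : 1 ≤ M.m) (hl₁ : 1 ≤ l) (hl₂ : l < M.n) : M.HasVUnit i l :=
  ((hasVSegment_iff (by omega)).1 (hM.vertical_lines i (by omega))).1 (by omega) l hl₁ hl₂

/-- A covered segment can end only where a side ends, that is, at a corner of a cell. Rows `1` and
`n` are covered entirely by admissibility, so this corner is an interior vertex. -/
lemma endsAreTJunctions_row (hM : M.IsAdmissible p q) (j : ℕ) :
    EndsAreTJunctions M.m (M.HasHUnit j) (M.IsTJunctionRight · j) (M.IsTJunctionLeft · j) where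
  range l h := ⟨h.bounds.1, h.bounds.2.1⟩
  right l hl₁ hl₂ h₁ h₂ := by
    have hb := h₁.bounds
    have hj : j ≠ 1 ∧ j ≠ M.n := by
      by_contra hcon
      exact h₂ (hasHUnit_of_first_or_last hM (by omega) (by omega) hl₁.le hl₂)
    refine ⟨⟨?_, by omega, by omega, by omega, by omega⟩, fun h => ?_⟩
    · obtain ⟨a, b, ⟨C, hC, h₃, rfl, rfl⟩, h₄, h₅⟩ := h₁
      refine ⟨C, hC, .inr ?_, h₃⟩
      by_contra hcon
      exact h₂ ⟨_, _, ⟨C, hC, h₃, rfl, rfl⟩, by omega, by omega⟩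
    · exact h₂ (isCovered_unit.1 ((hasHSegment_iff (by omega)).1 h))
  left l hl₁ hl₂ h₁ h₂ := by
    have hb := h₂.bounds
    have hj : j ≠ 1 ∧ j ≠ M.n := by
      by_contra hcon
      exact h₁ (hasHUnit_of_first_or_last hM (by omega) (by omega) (by omega) (by omega))
    refine ⟨⟨?_, by omega, by omega, by omega, by omega⟩, fun h => ?_⟩
    · obtain ⟨a, b, ⟨C, hC, h₃, rfl, rfl⟩, h₄, h₅⟩ := h₂
      refine ⟨C, hC, .inl ?_, h₃⟩
      by_contra hcon
      exact h₁ ⟨_, _, ⟨C, hC, h₃, rfl, rfl⟩, by omega, by omega⟩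
    · obtain ⟨d, rfl⟩ : ∃ d, l = d + 1 := ⟨l - 1, by omega⟩
      exact h₁ (isCovered_unit.1 ((hasHSegment_iff (by omega)).1 h))

lemma endsAreTJunctions_column (hM : M.IsAdmissible p q) (i : ℕ) :
    EndsAreTJunctions M.n (M.HasVUnit i) (M.IsTJunctionUp i) (M.IsTJunctionDown i) where
  range l h := ⟨h.bounds.1, h.bounds.2.1⟩
  right l hl₁ hl₂ h₁ h₂ := by
    have hb := h₁.bounds
    have hj : i ≠ 1 ∧ i ≠ M.m := by
      by_contra hcon
      exact h₂ (hasVUnit_of_first_or_last hM (by omega) (by omega) hl₁.le hl₂)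
    refine ⟨⟨?_, by omega, by omega, by omega, by omega⟩, fun h => ?_⟩
    · obtain ⟨a, b, ⟨C, hC, h₃, rfl, rfl⟩, h₄, h₅⟩ := h₁
      refine ⟨C, hC, h₃, .inr ?_⟩
      by_contra hcon
      exact h₂ ⟨_, _, ⟨C, hC, h₃, rfl, rfl⟩, by omega, by omega⟩
    · exact h₂ (isCovered_unit.1 ((hasVSegment_iff (by omega)).1 h))
  left l hl₁ hl₂ h₁ h₂ := by
    have hb := h₂.bounds
    have hj : i ≠ 1 ∧ i ≠ M.m := by
      by_contra hcon
      exact h₁ (hasVUnit_of_first_or_last hM (by omega) (by omega) (by omega) (by omega))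
    refine ⟨⟨?_, by omega, by omega, by omega, by omega⟩, fun h => ?_⟩
    · obtain ⟨a, b, ⟨C, hC, h₃, rfl, rfl⟩, h₄, h₅⟩ := h₂
      refine ⟨C, hC, h₃, .inl ?_⟩
      by_contra hcon
      exact h₁ ⟨_, _, ⟨C, hC, h₃, rfl, rfl⟩, by omega, by omega⟩
    · obtain ⟨d, rfl⟩ : ∃ d, l = d + 1 := ⟨l - 1, by omega⟩
      exact h₁ (isCovered_unit.1 ((hasVSegment_iff (by omega)).1 h))

lemma IsVertex.mem_hIndices {i j : ℕ} (h : M.IsVertex i j) : i ∈ M.hIndices j j := by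
  obtain ⟨C, hC, hi, hj⟩ := h
  have := M.cells_valid C hC
  refine (hasVSegment_iff le_rfl).2 ⟨by omega, fun _ => ?_⟩
  rcases hj with rfl | rfl
  · exact .inr ⟨_, _, ⟨C, hC, hi, rfl, rfl⟩, by omega, by omega⟩
  · exact .inl ⟨_, _, ⟨C, hC, hi, rfl, rfl⟩, by omega, by omega⟩

lemma IsVertex.mem_vIndices {i j : ℕ} (h : M.IsVertex i j) : j ∈ M.vIndices i i := by
  obtain ⟨C, hC, hi, hj⟩ := h
  have := M.cells_valid C hC
  refine (hasHSegment_iff le_rfl).2 ⟨by omega, fun _ => ?_⟩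
  rcases hi with rfl | rfl
  · exact .inr ⟨_, _, ⟨C, hC, hj, rfl, rfl⟩, by omega, by omega⟩
  · exact .inl ⟨_, _, ⟨C, hC, hj, rfl, rfl⟩, by omega, by omega⟩

lemma HasHSegment.mem_vIndices {i₁ i₂ i j : ℕ} (h : M.HasHSegment i₁ i₂ j) (h₁ : i₁ ≤ i)
    (h₂ : i ≤ i₂) : j ∈ M.vIndices i i := by
  refine Set.Subset.trans (Set.prod_mono_left (Set.Icc_subset_Icc ?_ ?_)) h <;> exact_mod_cast ‹_›

lemma HasVSegment.mem_hIndices {i j₁ j₂ j : ℕ} (h : M.HasVSegment i j₁ j₂) (h₁ : j₁ ≤ j)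
    (h₂ : j ≤ j₂) : i ∈ M.hIndices j j := by
  refine Set.Subset.trans (Set.prod_mono_right (Set.Icc_subset_Icc ?_ ?_)) h <;> exact_mod_cast ‹_›

/-- T-junctions lie outside the frame, and on either side the frame contributes `(p + 1) / 2`
complete vertical lines beyond them. Every row meets these lines, so the extensions never run out of
stations. -/
lemma hasStations_row (hM : M.IsAdmissible p q) (j : ℕ) :
    HasStations p (M.hIndices j j) (M.IsTJunctionRight · j) (M.IsTJunctionLeft · j) := by
  have hvert : ∀ i, M.IsTJunctionRight i j ∨ M.IsTJunctionLeft i j → M.IsInteriorVertex i j := by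
    rintro i (h | h) <;> exact h.1
  have hframe : ∀ i, M.IsTJunctionRight i j ∨ M.IsTJunctionLeft i j →
      1 + (p + 1) / 2 < i ∧ i + (p + 1) / 2 < M.m := by
    intro i h
    by_contra hcon
    have := hM.no_tjunction i j (by unfold InFrameRegion; omega)
    tauto
  refine ⟨fun i h => (hvert i h).1.mem_hIndices, fun i h k hk => ?_, fun i h k hk => ?_⟩
  · refine exists_ncard_inter_Ioc (N := M.m) (hvert i h).1.mem_hIndices k (hk.trans ?_)
    have hf := hframe i h
    have hv := hvert i h
    have hsub : ((Finset.Ioc (M.m - (p + 1) / 2) M.m : Finset ℕ) : Set ℕ) ⊆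
        M.hIndices j j ∩ Set.Ioc i M.m := by
      intro x hx
      simp only [Finset.coe_Ioc, Set.mem_Ioc] at hx
      exact ⟨(hM.vertical_lines x (by omega)).mem_hIndices hv.2.2.2.1.le hv.2.2.2.2.le,
        by omega, by omega⟩
    have := Set.ncard_le_ncard hsub ((Set.finite_Ioc _ _).inter_of_right _)
    rw [Set.ncard_coe_finset, Nat.card_Ioc] at this
    omega
  · refine exists_ncard_inter_Ico (hvert i h).1.mem_hIndices k (hk.trans ?_)
    have hf := hframe i h
    have hv := hvert i h
    have hsub : ((Finset.Icc 1 ((p + 1) / 2) : Finset ℕ) : Set ℕ) ⊆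
        M.hIndices j j ∩ Set.Ico 0 i := by
      intro x hx
      simp only [Finset.coe_Icc, Set.mem_Icc] at hx
      exact ⟨(hM.vertical_lines x (by omega)).mem_hIndices hv.2.2.2.1.le hv.2.2.2.2.le,
        by omega, by omega⟩
    have := Set.ncard_le_ncard hsub ((Set.finite_Ico _ _).inter_of_right _)
    rw [Set.ncard_coe_finset, Nat.card_Icc] at this
    omega

lemma hasStations_column (hM : M.IsAdmissible p q) (i : ℕ) :
    HasStations q (M.vIndices i i) (M.IsTJunctionUp i) (M.IsTJunctionDown i) := by
  have hvert : ∀ j, M.IsTJunctionUp i j ∨ M.IsTJunctionDown i j → M.IsInteriorVertex i j := by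
    rintro j (h | h) <;> exact h.1
  have hframe : ∀ j, M.IsTJunctionUp i j ∨ M.IsTJunctionDown i j →
      1 + (q + 1) / 2 < j ∧ j + (q + 1) / 2 < M.n := by
    intro j h
    by_contra hcon
    have := hM.no_tjunction i j (by unfold InFrameRegion; omega)
    tauto
  refine ⟨fun j h => (hvert j h).1.mem_vIndices, fun j h k hk => ?_, fun j h k hk => ?_⟩
  · refine exists_ncard_inter_Ioc (N := M.n) (hvert j h).1.mem_vIndices k (hk.trans ?_)
    have hf := hframe j h
    have hv := hvert j h
    have hsub : ((Finset.Ioc (M.n - (q + 1) / 2) M.n : Finset ℕ) : Set ℕ) ⊆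
        M.vIndices i i ∩ Set.Ioc j M.n := by
      intro x hx
      simp only [Finset.coe_Ioc, Set.mem_Ioc] at hx
      exact ⟨(hM.horizontal_lines x (by omega)).mem_vIndices hv.2.1.le hv.2.2.1.le,
        by omega, by omega⟩
    have := Set.ncard_le_ncard hsub ((Set.finite_Ioc _ _).inter_of_right _)
    rw [Set.ncard_coe_finset, Nat.card_Ioc] at this
    omega
  · refine exists_ncard_inter_Ico (hvert j h).1.mem_vIndices k (hk.trans ?_)
    have hf := hframe j h
    have hv := hvert j h
    have hsub : ((Finset.Icc 1 ((q + 1) / 2) : Finset ℕ) : Set ℕ) ⊆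
        M.vIndices i i ∩ Set.Ico 0 j := by
      intro x hx
      simp only [Finset.coe_Icc, Set.mem_Icc] at hx
      exact ⟨(hM.horizontal_lines x (by omega)).mem_vIndices hv.2.1.le hv.2.2.1.le,
        by omega, by omega⟩
    have := Set.ncard_le_ncard hsub ((Set.finite_Ico _ _).inter_of_right _)
    rw [Set.ncard_coe_finset, Nat.card_Icc] at this
    omega

/-- A cell with a corner in the interior of `C` shares a unit square with `C`, so it is `C` itself,
whose corners are not interior. -/
lemma not_isVertex_of_mem_interior {C : Box} (hC : C ∈ M.cells) {i j : ℕ} (h₁ : C.left < i)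
    (h₂ : i < C.right) (h₃ : C.bottom < j) (h₄ : j < C.top) : ¬ M.IsVertex i j := by
  rintro ⟨D, hD, hi, hj⟩
  have hCv := M.cells_valid C hC
  have hDv := M.cells_valid D hD
  obtain ⟨x, hx⟩ : ∃ x, C.left ≤ x ∧ x < C.right ∧ D.left ≤ x ∧ x < D.right := by
    rcases hi with rfl | rfl
    · exact ⟨D.left, by omega⟩
    · exact ⟨D.right - 1, by omega⟩
  obtain ⟨y, hy⟩ : ∃ y, C.bottom ≤ y ∧ y < C.top ∧ D.bottom ≤ y ∧ y < D.top := by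
    rcases hj with rfl | rfl
    · exact ⟨D.bottom, by omega⟩
    · exact ⟨D.top - 1, by omega⟩
  have := (M.cells_partition x y (by omega) (by omega) (by omega) (by omega)).unique
    ⟨hC, by omega, by omega, by omega, by omega⟩ ⟨hD, by omega, by omega, by omega, by omega⟩
  subst this
  omega

/-! ### Extensions reach every point of the index support of an anchor -/

/-- The vertex `(i, j)` lies in some horizontal T-junction extension. -/
def IsHReached (M : TMesh) (p i j : ℕ) : Prop :=
  IsReached p (M.hIndices j j) (M.IsTJunctionRight · j) (M.IsTJunctionLeft · j) i

/-- The vertex `(i, j)` lies in some vertical T-junction extension. -/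
def IsVReached (M : TMesh) (q i j : ℕ) : Prop :=
  IsReached q (M.vIndices i i) (M.IsTJunctionUp i) (M.IsTJunctionDown i) j

lemma IsAnalysisSuitable.not_isReached (h : M.IsAnalysisSuitable p q) {i j : ℕ}
    (h₁ : M.IsHReached p i j) (h₂ : M.IsVReached q i j) : False := by
  obtain ⟨e₁, e₂, he, h₃, h₄⟩ := h₁
  obtain ⟨f₁, f₂, hf, h₅, h₆⟩ := h₂
  exact h e₁ e₂ j i f₁ f₂ he hf ⟨h₃, h₄, h₅, h₆⟩

/-- An anchor of the mesh together with its local index vectors. -/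
structure IsIndexedAnchor (M : TMesh) (p q : ℕ) (A : Box) (v : Fin (p + 2) → ℕ)
    (w : Fin (q + 2) → ℕ) : Prop where
  anchor : M.IsAnchor p q A
  hVector : IsLocalIndexVector p (M.hIndices A.bottom A.top) A.left A.right v
  vVector : IsLocalIndexVector q (M.vIndices A.left A.right) A.bottom A.top w

section Anchor

variable {A : Box} {v : Fin (p + 2) → ℕ} {w : Fin (q + 2) → ℕ}

lemma IsIndexedAnchor.not_isVertex (hA : M.IsIndexedAnchor p q A v w) {i j : ℕ} (h₁ : A.left < i)
    (h₂ : i < A.right) (h₃ : A.bottom < j) (h₄ : j < A.top) : ¬ M.IsVertex i j := by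
  rcases hA.anchor.2 with h | h | h | h
  · omega
  · omega
  · omega
  · exact not_isVertex_of_mem_interior h.2.2 h₁ h₂ h₃ h₄

/-- Every horizontal T-junction between the anchor and `(i, j)` has an extension through `(i, j)`. -/
def ReachesH (M : TMesh) (p : ℕ) (A : Box) (i j : ℕ) : Prop :=
  (∃ i', IsBetween (M.IsTJunctionRight · j) (M.IsTJunctionLeft · j) A.left A.right i i') →
    M.IsHReached p i j

/-- Every vertical T-junction between the anchor and `(i, j)` has an extension through `(i, j)`. -/
def ReachesV (M : TMesh) (q : ℕ) (A : Box) (i j : ℕ) : Prop :=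
  (∃ j', IsBetween (M.IsTJunctionUp i) (M.IsTJunctionDown i) A.bottom A.top j j') →
    M.IsVReached q i j

/-- If the T-junction extension misses `(i, j)`, a horizontally reached station `k` closer to the
anchor is not in its index vector. Column `k` is then covered at `(k, j)` but not along the anchor,
which puts a vertical T-junction between them. So `(k, j)` would be reached vertically as well,
contrary to analysis-suitability. -/
lemma IsIndexedAnchor.reachesH_of_reachesV (hM : M.IsAdmissible p q)
    (hS : M.IsAnalysisSuitable p q) (hA : M.IsIndexedAnchor p q A v w) {i j : ℕ}
    (hi₀ : v 0 ≤ i) (hi₁ : i ≤ v (Fin.last (p + 1)))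
    (h : ∀ k, v 0 ≤ k → k ≤ v (Fin.last (p + 1)) → k ≠ A.left → k ≠ A.right →
      ((k < i ∧ A.left < k) ∨ (i < k ∧ k < A.right)) → M.ReachesV q A k j) :
    M.ReachesH p A i j := by
  rintro ⟨i', hi'⟩
  refine (hi'.isReached_or (hasStations_row hM j) hA.hVector hi₀ hi₁).resolve_right ?_
  rintro ⟨k, hk, hk', hr, h₁, h₂, h₃⟩
  have hbt := hA.vVector.left_le_right
  have hb := mem_vIndices_bounds hA.hVector.left_le_right hA.vVector.left_mem
  have ht := mem_vIndices_bounds hA.hVector.left_le_right hA.vVector.right_mem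
  refine hS.not_isReached hr (h k h₁ h₂ ?_ ?_ h₃ ?_)
  · rintro rfl
    exact hk' hA.hVector.left_mem
  · rintro rfl
    exact hk' hA.hVector.right_mem
  · exact (endsAreTJunctions_column hM k).exists_isBetween hbt hb.1 ht.2
      (fun hc => hk' ((hasVSegment_iff hbt).2 hc)) ((hasVSegment_iff le_rfl).1 hk)

lemma IsIndexedAnchor.reachesV_of_reachesH (hM : M.IsAdmissible p q)
    (hS : M.IsAnalysisSuitable p q) (hA : M.IsIndexedAnchor p q A v w) {i j : ℕ}
    (hj₀ : w 0 ≤ j) (hj₁ : j ≤ w (Fin.last (q + 1)))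
    (h : ∀ k, w 0 ≤ k → k ≤ w (Fin.last (q + 1)) → k ≠ A.bottom → k ≠ A.top →
      ((k < j ∧ A.bottom < k) ∨ (j < k ∧ k < A.top)) → M.ReachesH p A i k) :
    M.ReachesV q A i j := by
  rintro ⟨j', hj'⟩
  refine (hj'.isReached_or (hasStations_column hM i) hA.vVector hj₀ hj₁).resolve_right ?_
  rintro ⟨k, hk, hk', hr, h₁, h₂, h₃⟩
  have hbt := hA.hVector.left_le_right
  have hb := mem_hIndices_bounds hA.vVector.left_le_right hA.hVector.left_mem
  have ht := mem_hIndices_bounds hA.vVector.left_le_right hA.hVector.right_mem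
  refine hS.not_isReached (h k h₁ h₂ ?_ ?_ h₃ ?_) hr
  · rintro rfl
    exact hk' hA.vVector.left_mem
  · rintro rfl
    exact hk' hA.vVector.right_mem
  · exact (endsAreTJunctions_row hM k).exists_isBetween hbt hb.1 ht.2
      (fun hc => hk' ((hasHSegment_iff hbt).2 hc)) ((hasHSegment_iff le_rfl).1 hk)

/-- Induction on the distance from the anchor: each direction at `(i, j)` reduces to the other
direction at points closer to the anchor. The summands `+ 1` make a distance zero exactly strictly
between the end points of the side. Inside the anchor in both senses the anchor is a cell, and there
are no vertices at all. -/
lemma IsIndexedAnchor.reaches (hM : M.IsAdmissible p q)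
    (hS : M.IsAnalysisSuitable p q) (hA : M.IsIndexedAnchor p q A v w) (N : ℕ) :
    ∀ i j, (i + 1 - A.right + (A.left + 1 - i)) + (j + 1 - A.top + (A.bottom + 1 - j)) = N →
      v 0 ≤ i → i ≤ v (Fin.last (p + 1)) → w 0 ≤ j → j ≤ w (Fin.last (q + 1)) →
      M.ReachesH p A i j ∧ M.ReachesV q A i j := by
  induction N using Nat.strong_induction_on with
  | _ N ih =>
    intro i j hN hi₀ hi₁ hj₀ hj₁
    have hlr := hA.hVector.left_le_right
    have hbt := hA.vVector.left_le_right
    by_cases hi : A.left < i ∧ i < A.right <;> by_cases hj : A.bottom < j ∧ j < A.top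
    · constructor
      · rintro ⟨i', h, h'⟩
        refine absurd ?_ (hA.not_isVertex (i := i') (j := j) (by omega) (by omega) hj.1 hj.2)
        rcases h with h | h <;> exact h.1.1
      · rintro ⟨j', h, h'⟩
        refine absurd ?_ (hA.not_isVertex (i := i) (j := j') hi.1 hi.2 (by omega) (by omega))
        rcases h with h | h <;> exact h.1.1
    -- Points `(k, j)` with `k` inside the side all have the same distance, so the induction
    -- hypothesis cannot compare them. The vertical claim is therefore proved for all of them at
    -- once, and the horizontal claim follows from it.
    · have hV : ∀ k, v 0 ≤ k → k ≤ v (Fin.last (p + 1)) → A.left < k ∧ k < A.right →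
          M.ReachesV q A k j := fun k hk₀ hk₁ hk =>
        hA.reachesV_of_reachesH hM hS hj₀ hj₁ fun l hl₀ hl₁ hlb hlt h =>
          (ih _ (by omega) k l rfl hk₀ hk₁ hl₀ hl₁).1
      exact ⟨hA.reachesH_of_reachesV hM hS hi₀ hi₁ fun k hk₀ hk₁ hkl hkr h =>
        hV k hk₀ hk₁ (by omega), hV i hi₀ hi₁ hi⟩
    · have hH : ∀ k, w 0 ≤ k → k ≤ w (Fin.last (q + 1)) → A.bottom < k ∧ k < A.top →
          M.ReachesH p A i k := fun k hk₀ hk₁ hk =>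
        hA.reachesH_of_reachesV hM hS hi₀ hi₁ fun l hl₀ hl₁ hlb hlt h =>
          (ih _ (by omega) l k rfl hl₀ hl₁ hk₀ hk₁).2
      exact ⟨hH j hj₀ hj₁ hj, hA.reachesV_of_reachesH hM hS hj₀ hj₁ fun k hk₀ hk₁ hkl hkr h =>
        hH k hk₀ hk₁ (by omega)⟩
    · exact ⟨hA.reachesH_of_reachesV hM hS hi₀ hi₁ fun k hk₀ hk₁ hkl hkr h =>
          (ih _ (by omega) k j rfl hk₀ hk₁ hj₀ hj₁).2,
        hA.reachesV_of_reachesH hM hS hj₀ hj₁ fun k hk₀ hk₁ hkl hkr h =>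
          (ih _ (by omega) i k rfl hi₀ hi₁ hk₀ hk₁).1⟩

end Anchor

end TMesh

/-! ### Dual compatibility -/

/-- Two index vectors overlap: inside the range of the other vector, each has only entries of the
other. -/
def Overlap {p : ℕ} (v v' : Fin (p + 2) → ℕ) : Prop :=
  (∀ k, v' 0 ≤ v k → v k ≤ v' (Fin.last (p + 1)) → v k ∈ Set.range v') ∧
    ∀ k, v 0 ≤ v' k → v' k ≤ v (Fin.last (p + 1)) → v' k ∈ Set.range v

lemma IsLocalIndexVector.overlap {p : ℕ} {S : Set ℕ} {a₁ a₂ a₁' a₂' : ℕ} {v v' : Fin (p + 2) → ℕ}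
    (hv : IsLocalIndexVector p S a₁ a₂ v) (hv' : IsLocalIndexVector p S a₁' a₂' v') :
    Overlap v v' :=
  ⟨fun k => hv'.successive _ (hv.mem k), fun k => hv.successive _ (hv'.mem k)⟩

lemma IsLocalIndexVector.exists_of_not_overlap {p : ℕ} {S S' : Set ℕ} {a₁ a₂ a₁' a₂' : ℕ}
    {v v' : Fin (p + 2) → ℕ} (hv : IsLocalIndexVector p S a₁ a₂ v)
    (hv' : IsLocalIndexVector p S' a₁' a₂' v') (h : ¬ Overlap v v') :
    ∃ i, v 0 ≤ i ∧ i ≤ v (Fin.last (p + 1)) ∧ v' 0 ≤ i ∧ i ≤ v' (Fin.last (p + 1)) ∧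
      ((i ∈ S ∧ i ∉ S') ∨ (i ∈ S' ∧ i ∉ S)) := by
  rw [Overlap, not_and_or] at h
  push Not at h
  rcases h with ⟨k, h₁, h₂, h₃⟩ | ⟨k, h₁, h₂, h₃⟩
  · exact ⟨v k, hv.zero_le k, hv.le_last k, h₁, h₂,
      .inl ⟨hv.mem k, fun h => h₃ (hv'.successive _ h h₁ h₂)⟩⟩
  · exact ⟨v' k, h₁, h₂, hv'.zero_le k, hv'.le_last k,
      .inr ⟨hv'.mem k, fun h => h₃ (hv.successive _ h h₁ h₂)⟩⟩

namespace TMesh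

variable {M : TMesh} {p q : ℕ} {A A' : Box} {v v' : Fin (p + 2) → ℕ} {w w' : Fin (q + 2) → ℕ}

/-- Column `i` is covered along `A` but not along `A'`. If it is covered at `(i, j)`, a T-junction
lies between `A'` and `(i, j)`; if not, one lies between `A` and `(i, j)`. In both cases `reaches`
applies to the anchor concerned. -/
lemma IsIndexedAnchor.isVReached_of_mem_of_notMem (hM : M.IsAdmissible p q)
    (hS : M.IsAnalysisSuitable p q) (hA : M.IsIndexedAnchor p q A v w)
    (hA' : M.IsIndexedAnchor p q A' v' w') {i j : ℕ}
    (hi₀ : v 0 ≤ i) (hi₁ : i ≤ v (Fin.last (p + 1)))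
    (hi₀' : v' 0 ≤ i) (hi₁' : i ≤ v' (Fin.last (p + 1)))
    (hj₀ : w 0 ≤ j) (hj₁ : j ≤ w (Fin.last (q + 1)))
    (hj₀' : w' 0 ≤ j) (hj₁' : j ≤ w' (Fin.last (q + 1)))
    (hmem : i ∈ M.hIndices A.bottom A.top) (hmem' : i ∉ M.hIndices A'.bottom A'.top) :
    M.IsVReached q i j := by
  have hbt := hA.vVector.left_le_right
  have hbt' := hA'.vVector.left_le_right
  by_cases hij : IsCovered (M.HasVUnit i) j j
  · refine (hA'.reaches hM hS _ i j rfl hi₀' hi₁' hj₀' hj₁').2 ?_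
    refine (endsAreTJunctions_column hM i).exists_isBetween hbt' ?_ ?_
      (fun hc => hmem' ((hasVSegment_iff hbt').2 hc)) hij
    · exact (mem_vIndices_bounds hA'.hVector.left_le_right hA'.vVector.left_mem).1
    · exact (mem_vIndices_bounds hA'.hVector.left_le_right hA'.vVector.right_mem).2
  · refine (hA.reaches hM hS _ i j rfl hi₀ hi₁ hj₀ hj₁).2 ?_
    refine (endsAreTJunctions_column hM i).exists_isBetween' hbt ?_ ?_
      ((hasVSegment_iff hbt).1 hmem) hij
    · exact (mem_vIndices_bounds hA.hVector.left_le_right (hA.vVector.mem 0)).1.trans hj₀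
    · exact hj₁.trans (mem_vIndices_bounds hA.hVector.left_le_right (hA.vVector.mem _)).2

lemma IsIndexedAnchor.isHReached_of_mem_of_notMem (hM : M.IsAdmissible p q)
    (hS : M.IsAnalysisSuitable p q) (hA : M.IsIndexedAnchor p q A v w)
    (hA' : M.IsIndexedAnchor p q A' v' w') {i j : ℕ}
    (hi₀ : v 0 ≤ i) (hi₁ : i ≤ v (Fin.last (p + 1)))
    (hi₀' : v' 0 ≤ i) (hi₁' : i ≤ v' (Fin.last (p + 1)))
    (hj₀ : w 0 ≤ j) (hj₁ : j ≤ w (Fin.last (q + 1)))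
    (hj₀' : w' 0 ≤ j) (hj₁' : j ≤ w' (Fin.last (q + 1)))
    (hmem : j ∈ M.vIndices A.left A.right) (hmem' : j ∉ M.vIndices A'.left A'.right) :
    M.IsHReached p i j := by
  have hbt := hA.hVector.left_le_right
  have hbt' := hA'.hVector.left_le_right
  by_cases hij : IsCovered (M.HasHUnit j) i i
  · refine (hA'.reaches hM hS _ i j rfl hi₀' hi₁' hj₀' hj₁').1 ?_
    refine (endsAreTJunctions_row hM j).exists_isBetween hbt' ?_ ?_
      (fun hc => hmem' ((hasHSegment_iff hbt').2 hc)) hij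
    · exact (mem_hIndices_bounds hA'.vVector.left_le_right hA'.hVector.left_mem).1
    · exact (mem_hIndices_bounds hA'.vVector.left_le_right hA'.hVector.right_mem).2
  · refine (hA.reaches hM hS _ i j rfl hi₀ hi₁ hj₀ hj₁).1 ?_
    refine (endsAreTJunctions_row hM j).exists_isBetween' hbt ?_ ?_
      ((hasHSegment_iff hbt).1 hmem) hij
    · exact (mem_hIndices_bounds hA.vVector.left_le_right (hA.hVector.mem 0)).1.trans hi₀
    · exact hi₁.trans (mem_hIndices_bounds hA.vVector.left_le_right (hA.hVector.mem _)).2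

/-- Analysis-suitable meshes are dual-compatible: any two anchors have overlapping local index vectors
in at least one direction. -/
theorem IsIndexedAnchor.overlap_or_overlap (hM : M.IsAdmissible p q)
    (hS : M.IsAnalysisSuitable p q) (hA : M.IsIndexedAnchor p q A v w)
    (hA' : M.IsIndexedAnchor p q A' v' w') : Overlap v v' ∨ Overlap w w' := by
  by_contra! hcon
  obtain ⟨i, hi₀, hi₁, hi₀', hi₁', hi⟩ := hA.hVector.exists_of_not_overlap hA'.hVector hcon.1
  obtain ⟨j, hj₀, hj₁, hj₀', hj₁', hj⟩ := hA.vVector.exists_of_not_overlap hA'.vVector hcon.2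
  refine hS.not_isReached (i := i) (j := j) ?_ ?_
  · rcases hj with ⟨h, h'⟩ | ⟨h, h'⟩
    · exact hA.isHReached_of_mem_of_notMem hM hS hA' hi₀ hi₁ hi₀' hi₁' hj₀ hj₁ hj₀' hj₁' h h'
    · exact hA'.isHReached_of_mem_of_notMem hM hS hA hi₀' hi₁' hi₀ hi₁ hj₀' hj₁' hj₀ hj₁ h h'
  · rcases hi with ⟨h, h'⟩ | ⟨h, h'⟩
    · exact hA.isVReached_of_mem_of_notMem hM hS hA' hi₀ hi₁ hi₀' hi₁' hj₀ hj₁ hj₀' hj₁' h h'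
    · exact hA'.isVReached_of_mem_of_notMem hM hS hA hi₀' hi₁' hi₀ hi₁ hj₀' hj₁' hj₀ hj₁ h h'

/-- Two different pairs of local index vectors overlap and differ in the same direction. -/
theorem IsIndexedAnchor.overlap_ne_or_overlap_ne (hM : M.IsAdmissible p q)
    (hS : M.IsAnalysisSuitable p q) (hA : M.IsIndexedAnchor p q A v w)
    (hA' : M.IsIndexedAnchor p q A' v' w') (hne : ¬ (v = v' ∧ w = w')) :
    (Overlap v v' ∧ v ≠ v') ∨ (Overlap w w' ∧ w ≠ w') := by
  by_cases hv : v = v'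
  · refine .inr ⟨?_, fun h => hne ⟨hv, h⟩⟩
    -- The middle entries of `v` determine the horizontal side of the anchor, so `w` and `w'` are
    -- selected from the same index set.
    have h₁ := hA.hVector.apply_left
    have h₂ := hA.hVector.apply_right
    rw [hv, hA'.hVector.apply_left] at h₁
    rw [hv, hA'.hVector.apply_right] at h₂
    have := hA'.vVector
    rw [h₁, h₂] at this
    exact hA.vVector.overlap this
  by_cases hw : w = w'
  · refine .inl ⟨?_, hv⟩
    have h₁ := hA.vVector.apply_left
    have h₂ := hA.vVector.apply_right
    rw [hw, hA'.vVector.apply_left] at h₁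
    rw [hw, hA'.vVector.apply_right] at h₂
    have := hA'.hVector
    rw [h₁, h₂] at this
    exact hA.hVector.overlap this
  exact (hA.overlap_or_overlap hM hS hA').imp (fun h => ⟨h, hv⟩) fun h => ⟨h, hw⟩

end TMesh

/-! ### Polynomial pieces of B-splines and Marsden's identity -/

open Polynomial

/-- The polynomial that coincides with the B-spline `N[x 0, …, x (p + 1)]` to the right of `s₀`. -/
noncomputable def bSplinePiece (s₀ : ℝ) : (p : ℕ) → (Fin (p + 2) → ℝ) → ℝ[X]
  | 0, x => C (Set.indicator (Set.Ico (x 0) (x 1)) 1 s₀)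
  | p + 1, x =>
    C (x (Fin.last (p + 1)).castSucc - x 0)⁻¹ * (X - C (x 0)) *
        bSplinePiece s₀ p (fun k => x k.castSucc) +
      C (x (Fin.last (p + 2)) - x 1)⁻¹ * (C (x (Fin.last (p + 2))) - X) *
        bSplinePiece s₀ p (fun k => x k.succ)

/-- The hypothesis says that no knot separates `s` from `s₀`; the indicators at the bottom of the
recursion, the only non-polynomial ingredient, then agree at both points. -/
lemma bSpline_eq_eval_bSplinePiece {s₀ s : ℝ} : ∀ (p : ℕ) (x : Fin (p + 2) → ℝ),
    (∀ k, x k ≤ s ↔ x k ≤ s₀) → bSpline p x s = (bSplinePiece s₀ p x).eval s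
  | 0, x, h => by
    have h₀ := h 0
    have h₁ := h 1
    rw [← not_iff_not, not_le, not_le] at h₁
    simp only [bSpline, bSplinePiece, eval_C, Set.indicator_apply, Set.mem_Ico, h₀, h₁]
    rfl
  | p + 1, x, h => by
    simp only [bSpline, bSplinePiece, eval_add, eval_mul, eval_C, eval_sub, eval_X,
      bSpline_eq_eval_bSplinePiece p (fun k => x k.castSucc) (fun k => h _),
      bSpline_eq_eval_bSplinePiece p (fun k => x k.succ) (fun k => h _)]
    ring

lemma bSplinePiece_eq_zero {s₀ : ℝ} : ∀ (p : ℕ) (x : Fin (p + 2) → ℝ), Monotone x →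
    ¬ (x 0 ≤ s₀ ∧ s₀ < x (Fin.last (p + 1))) → bSplinePiece s₀ p x = 0
  | 0, x, _, h => by
    have : s₀ ∉ Set.Ico (x 0) (x 1) := h
    rw [bSplinePiece, Set.indicator_of_notMem this, C_0]
  | p + 1, x, hx, h => by
    rw [bSplinePiece, bSplinePiece_eq_zero p (fun k => x k.castSucc), bSplinePiece_eq_zero p
      (fun k => x k.succ)]
    · simp
    · exact fun a b hab => hx (Fin.succ_le_succ_iff.2 hab)
    · exact fun hc => h ⟨(hx (Fin.zero_le _)).trans hc.1, hc.2⟩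
    · exact fun a b hab => hx (Fin.castSucc_le_castSucc_iff.2 hab)
    · exact fun hc => h ⟨hc.1, hc.2.trans_le (hx (Fin.le_last _))⟩

lemma bSpline_eq_zero {p : ℕ} {x : Fin (p + 2) → ℝ} (hx : Monotone x) {s : ℝ}
    (h : ¬ (x 0 ≤ s ∧ s < x (Fin.last (p + 1)))) : bSpline p x s = 0 := by
  rw [bSpline_eq_eval_bSplinePiece (s₀ := s) p x (fun _ => Iff.rfl), bSplinePiece_eq_zero p x hx h,
    eval_zero]

/-- The polynomial `∏ (X - x k)` over the inner knots. -/
noncomputable def innerKnotPoly (p : ℕ) (x : Fin (p + 2) → ℝ) : ℝ[X] :=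
  ∏ k : Fin p, (X - C (x k.succ.castSucc))

/-- De Boor's dual functional of the knot vector `x`, in coefficients. -/
noncomputable def dualFunctional (p : ℕ) (x : Fin (p + 2) → ℝ) : ℝ[X] →ₗ[ℝ] ℝ :=
  ∑ b : Fin (p + 1), ((-1) ^ (b : ℕ) / (p.choose b : ℝ) * (innerKnotPoly p x).coeff (p - b)) •
    lcoeff ℝ (b : ℕ)

lemma dualFunctional_apply (p : ℕ) (x : Fin (p + 2) → ℝ) (f : ℝ[X]) :
    dualFunctional p x f = ∑ b : Fin (p + 1),
      (-1) ^ (b : ℕ) / (p.choose b : ℝ) * (innerKnotPoly p x).coeff (p - b) * f.coeff b := by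
  simp [dualFunctional, LinearMap.sum_apply]

section Marsden

variable {z : ℕ → ℝ} {j : ℕ} {s₀ : ℝ}

/-- The window of `p + 2` successive knots of the sequence `z`, starting from the `i`-th. -/
def knotWindow (z : ℕ → ℝ) (p i : ℕ) : Fin (p + 2) → ℝ := fun k => z (i + k)

lemma bSplinePiece_knotWindow_eq_zero (hz : Monotone z) (hj₁ : z j ≤ s₀) (hj₂ : s₀ < z (j + 1))
    {p i : ℕ} (h : ¬ (i ≤ j ∧ j ≤ i + p)) : bSplinePiece s₀ p (knotWindow z p i) = 0 := by
  refine bSplinePiece_eq_zero p _ (fun a b hab => hz (by simpa using hab)) ?_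
  rintro ⟨h₁, h₂⟩
  simp only [knotWindow, Fin.val_zero, Fin.val_last, add_zero] at h₁ h₂
  refine h ⟨?_, ?_⟩
  · by_contra hcon
    exact absurd (hz (show j + 1 ≤ i by omega)) (by linarith)
  · by_contra hcon
    exact absurd (hz (show i + (p + 1) ≤ j by omega)) (by linarith)

lemma innerKnotPoly_knotWindow_succ_left (z : ℕ → ℝ) (p i : ℕ) :
    innerKnotPoly (p + 1) (knotWindow z (p + 1) i) =
      (X - C (z (i + 1))) * innerKnotPoly p (knotWindow z p (i + 1)) := by
  rw [innerKnotPoly, Fin.prod_univ_succ]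
  congr 1
  refine Finset.prod_congr rfl fun k _ => ?_
  simp only [knotWindow, Fin.val_castSucc, Fin.val_succ]
  ring_nf

lemma innerKnotPoly_knotWindow_succ_right (z : ℕ → ℝ) (p i : ℕ) :
    innerKnotPoly (p + 1) (knotWindow z (p + 1) i) =
      innerKnotPoly p (knotWindow z p i) * (X - C (z (i + (p + 1)))) := by
  rw [innerKnotPoly, Fin.prod_univ_castSucc]
  congr 1

/-- Marsden's identity on a knot interval. -/
lemma sub_pow_eq_sum_bSplinePiece (hz : Monotone z) (hj₁ : z j ≤ s₀) (hj₂ : s₀ < z (j + 1)) (y : ℝ) :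
    ∀ p, p ≤ j → (C y - X) ^ p = ∑ i ∈ Finset.range (j + 1),
      C ((innerKnotPoly p (knotWindow z p i)).eval y) * bSplinePiece s₀ p (knotWindow z p i) := by
  intro p
  induction p with
  | zero =>
    intro _
    rw [Finset.sum_eq_single_of_mem j (by simp)]
    · have : s₀ ∈ Set.Ico (z j) (z (j + 1)) := ⟨hj₁, hj₂⟩
      simp [innerKnotPoly, bSplinePiece, knotWindow, Set.indicator_of_mem this]
    · intro i hi hij
      rw [bSplinePiece_knotWindow_eq_zero hz hj₁ hj₂ (by omega), mul_zero]
  | succ p ih =>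
    intro hp
    set P : ℕ → ℝ[X] := fun i => bSplinePiece s₀ p (knotWindow z p i) with hP
    set ψ : ℕ → ℝ := fun i => (innerKnotPoly p (knotWindow z p i)).eval y with hψ
    have hrec : ∀ i, bSplinePiece s₀ (p + 1) (knotWindow z (p + 1) i) =
        C (z (i + (p + 1)) - z i)⁻¹ * (X - C (z i)) * P i +
          C (z (i + 1 + (p + 1)) - z (i + 1))⁻¹ * (C (z (i + 1 + (p + 1))) - X) * P (i + 1) := by
      intro i
      rw [bSplinePiece]
      have h₁ : (fun k : Fin (p + 2) => knotWindow z (p + 1) i k.castSucc) = knotWindow z p i := rfl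
      have h₂ : (fun k : Fin (p + 2) => knotWindow z (p + 1) i k.succ) = knotWindow z p (i + 1) := by
        funext k
        simp only [knotWindow, Fin.val_succ]
        ring_nf
      rw [h₁, h₂]
      have h₃ : i + (p + 2) = i + 1 + (p + 1) := by ring
      simp [knotWindow, hP, h₃]
    have hψl : ∀ i, (innerKnotPoly (p + 1) (knotWindow z (p + 1) i)).eval y =
        (y - z (i + 1)) * ψ (i + 1) := by
      intro i
      rw [innerKnotPoly_knotWindow_succ_left]
      simp [hψ]
    have hψr : ∀ i, (innerKnotPoly (p + 1) (knotWindow z (p + 1) i)).eval y =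
        ψ i * (y - z (i + (p + 1))) := by
      intro i
      rw [innerKnotPoly_knotWindow_succ_right]
      simp [hψ]
    have hzero : ∀ i, ¬ (i ≤ j ∧ j ≤ i + p) → P i = 0 := fun i h =>
      bSplinePiece_knotWindow_eq_zero hz hj₁ hj₂ h
    set F : ℕ → ℝ[X] := fun i => C ((y - z i) * ψ i) *
      (C (z (i + (p + 1)) - z i)⁻¹ * (C (z (i + (p + 1))) - X) * P i) with hF
    -- Windows `0` and `j + 1` of degree `p` do not contain the knot interval of `s₀`, as `p + 1 ≤
    -- j`. So the index shift loses no boundary term.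
    have hshift : ∑ i ∈ Finset.range (j + 1), F (i + 1) = ∑ i ∈ Finset.range (j + 1), F i := by
      have h₁ := Finset.sum_range_succ' F (j + 1)
      have h₂ := Finset.sum_range_succ F (j + 1)
      have h₃ : F 0 = 0 := by simp only [hF, hzero 0 (by omega), mul_zero]
      have h₄ : F (j + 1) = 0 := by simp only [hF, hzero (j + 1) (by omega), mul_zero]
      rw [h₃, add_zero] at h₁
      rw [h₄, add_zero] at h₂
      rw [← h₁, h₂]
    calc (C y - X) ^ (p + 1)
        = ∑ i ∈ Finset.range (j + 1), (C y - X) * (C (ψ i) * P i) := by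
          rw [pow_succ', ih (by omega), Finset.mul_sum]
      _ = ∑ i ∈ Finset.range (j + 1), (C (ψ i * (y - z (i + (p + 1)))) *
            (C (z (i + (p + 1)) - z i)⁻¹ * (X - C (z i)) * P i) + F i) := by
          -- With `a = z i` and `b = z (i + (p + 1))`, this is `(y - X) (b - a) = (y - b) (X - a) +
          -- (y - a) (b - X)`; where `b = a` is possible, the piece is zero.
          refine Finset.sum_congr rfl fun i _ => ?_
          by_cases hi : i ≤ j ∧ j ≤ i + p
          · have h₁ := hz hi.1
            have h₂ := hz (show j + 1 ≤ i + (p + 1) by omega)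
            have h₃ : z (i + (p + 1)) - z i ≠ 0 := by linarith
            have h₄ : C (z (i + (p + 1)) - z i) * C (z (i + (p + 1)) - z i)⁻¹ = 1 := by
              rw [← C_mul, mul_inv_cancel₀ h₃, C_1]
            have : (C y - X) = (C (z (i + (p + 1)) - z i) * C (z (i + (p + 1)) - z i)⁻¹) *
              (C y - X) := by rw [h₄, one_mul]
            rw [this]
            simp only [hF, C_mul, C_sub]
            ring
          · simp only [hF, hzero i hi, mul_zero, add_zero]
      _ = _ := by
          rw [Finset.sum_add_distrib, ← hshift, ← Finset.sum_add_distrib]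
          refine Finset.sum_congr rfl fun i _ => ?_
          rw [hrec, mul_add, ← hψr, hψl]

lemma coeff_C_sub_X_pow (y : ℝ) (p b : ℕ) :
    ((C y - X) ^ p : ℝ[X]).coeff b = (-1) ^ b * p.choose b * y ^ (p - b) := by
  have : (C y - X : ℝ[X]) = (X + C (-y)) * C (-1) := by
    simp only [C_neg, C_1]; ring
  rw [this, mul_pow, ← C_pow, coeff_mul_C, coeff_X_add_C_pow]
  rcases le_or_gt b p with h | h
  · obtain ⟨d, rfl⟩ := Nat.exists_eq_add_of_le h
    rw [Nat.add_sub_cancel_left, neg_pow y, pow_add]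
    have : ((-1 : ℝ) ^ d) * (-1) ^ d = 1 := by rw [← mul_pow]; norm_num
    linear_combination (y ^ d * ((b + d).choose b : ℝ) * (-1) ^ b) * this
  · simp [Nat.choose_eq_zero_of_lt h]

/-- Comparing coefficients in Marsden's identity, over the `p + 1` windows that are active at `s₀`,
gives a matrix identity `A * B = 1`. The matrices are square, so `B * A = 1`, and the entries of `B
* A` are the values of the dual functionals on the pieces. -/
lemma dualFunctional_knotWindow (hz : Monotone z) (hj₁ : z j ≤ s₀) (hj₂ : s₀ < z (j + 1))
    {p i k : ℕ} (hp : p ≤ j) (hi : i ≤ j) (hi' : j ≤ i + p) (hk : k ≤ j) (hk' : j ≤ k + p) :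
    dualFunctional p (knotWindow z p i) (bSplinePiece s₀ p (knotWindow z p k)) =
      if i = k then 1 else 0 := by
  set P : ℕ → ℝ[X] := fun i => bSplinePiece s₀ p (knotWindow z p i) with hP
  set ψ : ℕ → ℝ[X] := fun i => innerKnotPoly p (knotWindow z p i) with hψ
  have hcoeff : ∀ a b : ℕ, (∑ r : Fin (p + 1), (P (j - p + r)).coeff b * (ψ (j - p + r)).coeff a) =
      if a = p - b then (-1) ^ b * (p.choose b : ℝ) else 0 := by
    intro a b
    have hpoly : (∑ r : Fin (p + 1), C ((P (j - p + r)).coeff b) * ψ (j - p + r)) =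
        C ((-1) ^ b * (p.choose b : ℝ)) * X ^ (p - b) := by
      refine Polynomial.funext fun y => ?_
      have hM := congrArg (fun f => coeff f b) (sub_pow_eq_sum_bSplinePiece hz hj₁ hj₂ y p hp)
      simp only [coeff_C_sub_X_pow, finsetSum_coeff, coeff_C_mul] at hM
      rw [show j + 1 = (j - p) + (p + 1) by omega, Finset.sum_range_add, Finset.sum_eq_zero,
        zero_add] at hM
      · rw [eval_mul, eval_C, eval_pow, eval_X, hM, eval_finsetSum,
          Fin.sum_univ_eq_sum_range (fun r => eval y (C ((P (j - p + r)).coeff b) * ψ (j - p + r)))]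
        refine Finset.sum_congr rfl fun r _ => ?_
        rw [eval_mul, eval_C, mul_comm]
      · intro r hr
        rw [Finset.mem_range] at hr
        rw [bSplinePiece_knotWindow_eq_zero hz hj₁ hj₂ (by omega), coeff_zero, mul_zero]
    have := congrArg (fun f => coeff f a) hpoly
    simp only [finsetSum_coeff, coeff_C_mul, coeff_X_pow] at this
    rw [this]
    split_ifs <;> simp
  let A : Matrix (Fin (p + 1)) (Fin (p + 1)) ℝ := fun b r =>
    (-1) ^ (b : ℕ) / (p.choose b : ℝ) * (P (j - p + r)).coeff b
  let B : Matrix (Fin (p + 1)) (Fin (p + 1)) ℝ := fun r b => (ψ (j - p + r)).coeff (p - b)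
  have hAB : A * B = 1 := by
    ext b b'
    have : (A * B) b b' = (-1) ^ (b : ℕ) / (p.choose b : ℝ) *
        ∑ r : Fin (p + 1), (P (j - p + r)).coeff b * (ψ (j - p + r)).coeff (p - b') := by
      rw [Matrix.mul_apply, Finset.mul_sum]
      exact Finset.sum_congr rfl fun r _ => by simp only [A, B]; ring
    rw [this, hcoeff, Matrix.one_apply]
    have hb := b.2
    have hb' := b'.2
    by_cases hbb : b = b'
    · subst hbb
      have hc : (p.choose b : ℝ) ≠ 0 := by
        exact_mod_cast (Nat.choose_pos (by omega)).ne'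
      have h1 : ((-1 : ℝ) ^ (b : ℕ)) * (-1) ^ (b : ℕ) = 1 := by rw [← mul_pow]; norm_num
      rw [if_pos rfl, if_pos rfl]
      field_simp
      linear_combination h1
    · rw [if_neg hbb, if_neg, mul_zero]
      intro h
      exact hbb (Fin.ext (by omega))
  have hBA := mul_eq_one_comm.1 hAB
  obtain ⟨i, rfl⟩ : ∃ d, i = j - p + d := ⟨i - (j - p), by omega⟩
  obtain ⟨k, rfl⟩ : ∃ d, k = j - p + d := ⟨k - (j - p), by omega⟩
  have := congrFun (congrFun hBA ⟨i, by omega⟩) ⟨k, by omega⟩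
  rw [Matrix.one_apply, Matrix.mul_apply] at this
  rw [dualFunctional_apply]
  simp only [Fin.mk.injEq, add_right_inj] at this ⊢
  rw [← this]
  exact Finset.sum_congr rfl fun b _ => by simp only [A, B, hP, hψ]; ring

end Marsden

/-! ### Duality for overlapping index vectors -/

/-- Successive elements of an infinite set are consecutive in its enumeration. -/
lemma nth_count_add_of_successive {Z : ℕ → Prop} [DecidablePred Z] (hZ : ({n | Z n}).Infinite)
    {p : ℕ} {v : Fin (p + 2) → ℕ} (hv : StrictMono v) (hmem : ∀ k, Z (v k))
    (hsucc : ∀ i, Z i → v 0 ≤ i → i ≤ v (Fin.last (p + 1)) → ∃ k, v k = i) (k : Fin (p + 2)) :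
    Nat.nth Z (Nat.count Z (v 0) + k) = v k := by
  have key : ∀ (k : ℕ) (hk : k < p + 2), Nat.count Z (v ⟨k, hk⟩) = Nat.count Z (v 0) + k := by
    intro k
    induction k with
    | zero => intro _; rfl
    | succ k ih =>
      intro hk
      have hk' : k < p + 2 := by omega
      have hlt : v ⟨k, hk'⟩ < v ⟨k + 1, hk⟩ := hv (Fin.mk_lt_mk.2 (by omega))
      have h₁ := Nat.count_strict_mono (hmem ⟨k, hk'⟩) hlt
      by_contra hcon
      have h₂ : Nat.count Z (v ⟨k, hk'⟩) + 1 < Nat.count Z (v ⟨k + 1, hk⟩) := by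
        have := ih hk'
        omega
      have h₃ := Nat.nth_lt_of_lt_count h₂
      have h₄ : v ⟨k, hk'⟩ < Nat.nth Z (Nat.count Z (v ⟨k, hk'⟩) + 1) := by
        conv_lhs => rw [← Nat.nth_count (hmem ⟨k, hk'⟩)]
        exact Nat.nth_strictMono hZ (Nat.lt_succ_self _)
      obtain ⟨l, hl⟩ := hsucc _ (Nat.nth_mem_of_infinite hZ _)
        ((hv.monotone (Fin.zero_le _)).trans h₄.le) (h₃.le.trans (hv.monotone (Fin.le_last _)))
      rw [← hl, hv.lt_iff_lt, Fin.lt_def] at h₃ h₄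
      simp only at h₃ h₄
      omega
  rw [← key k k.2]
  exact Nat.nth_count (hmem k)

/-- The local form of de Boor's duality, for overlapping index vectors. -/
lemma dualFunctional_bSplinePiece {p m : ℕ} {x : ℕ → ℝ} (hx : MonotoneOn x (Set.Icc 1 m))
    {v v' : Fin (p + 2) → ℕ} (hv : StrictMono v) (hv' : StrictMono v')
    (hvm : ∀ k, v k ∈ Set.Icc 1 m) (hvm' : ∀ k, v' k ∈ Set.Icc 1 m) (ho : Overlap v v') {s₀ : ℝ}
    (h₀ : x (v 0) ≤ s₀) (h₁ : s₀ < x (v (Fin.last (p + 1)))) :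
    dualFunctional p (fun k => x (v k)) (bSplinePiece s₀ p (fun k => x (v' k))) =
      if v = v' then 1 else 0 := by
  classical
  by_cases hs : x (v' 0) ≤ s₀ ∧ s₀ < x (v' (Fin.last (p + 1)))
  swap
  · rw [bSplinePiece_eq_zero p _ (fun a b hab => hx (hvm' a) (hvm' b) (hv'.monotone hab)) hs,
      map_zero, if_neg]
    rintro rfl
    exact hs ⟨h₀, h₁⟩
  -- The entries of both vectors, shifted by `p + 1`, are merged into one index set; because the
  -- vectors overlap, each occupies successive places in it. The padding below supplies the `p`
  -- preceding knots that Marsden's identity needs, the padding above makes the set infinite.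
  -- Through `clamp` the padding repeats the knots `x 1` and `x m`.
  let Z : ℕ → Prop := fun c =>
    c < p + 1 ∨ (∃ k, c = v k + (p + 1)) ∨ (∃ k, c = v' k + (p + 1)) ∨ m + (p + 1) < c
  have hZ : ({n | Z n}).Infinite :=
    (Set.Ioi_infinite (m + (p + 1))).mono fun c hc => .inr (.inr (.inr hc))
  have hm : 1 ≤ m := (hvm 0).1.trans (hvm 0).2
  let clamp : ℕ → ℕ := fun c => max 1 (min m (c - (p + 1)))
  have hclamp : ∀ c, clamp c ∈ Set.Icc 1 m := fun c => ⟨le_max_left _ _, max_le hm (min_le_left _ _)⟩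
  let z : ℕ → ℝ := fun i => x (clamp (Nat.nth Z i))
  have hz : Monotone z := by
    intro a b hab
    refine hx (hclamp _) (hclamp _) ?_
    have : Nat.nth Z a ≤ Nat.nth Z b := Nat.nth_monotone hZ hab
    simp only [clamp]
    omega
  have hwin : ∀ u : Fin (p + 2) → ℕ, (∀ k, u k ∈ Set.Icc 1 m) →
      (∀ k : Fin (p + 2), Nat.nth Z (Nat.count Z (u 0 + (p + 1)) + k) = u k + (p + 1)) →
      (fun k => x (u k)) = knotWindow z p (Nat.count Z (u 0 + (p + 1))) := by
    intro u hu hnth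
    funext k
    have := hu k
    simp only [knotWindow, z, hnth k, clamp, Nat.add_sub_cancel]
    rw [min_eq_right this.2, max_eq_right this.1]
  have hnth := nth_count_add_of_successive hZ (v := fun k => v k + (p + 1))
    (fun a b hab => Nat.add_lt_add_right (hv hab) _) (fun k => .inr (.inl ⟨k, rfl⟩)) (by
      rintro i (hi | ⟨k, rfl⟩ | ⟨k, rfl⟩ | hi) hi₀ hi₁
      · omega
      · exact ⟨k, rfl⟩
      · obtain ⟨l, hl⟩ := ho.2 k (by omega) (by omega)
        exact ⟨l, by rw [hl]⟩
      · have := (hvm (Fin.last (p + 1))).2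
        omega)
  have hnth' := nth_count_add_of_successive hZ (v := fun k => v' k + (p + 1))
    (fun a b hab => Nat.add_lt_add_right (hv' hab) _) (fun k => .inr (.inr (.inl ⟨k, rfl⟩))) (by
      rintro i (hi | ⟨k, rfl⟩ | ⟨k, rfl⟩ | hi) hi₀ hi₁
      · omega
      · obtain ⟨l, hl⟩ := ho.1 k (by omega) (by omega)
        exact ⟨l, by rw [hl]⟩
      · exact ⟨k, rfl⟩
      · have := (hvm' (Fin.last (p + 1))).2
        omega)
  have hw := hwin v hvm hnth
  have hw' := hwin v' hvm' hnth'
  have hr : p + 1 ≤ Nat.count Z (v 0 + (p + 1)) := by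
    refine le_trans (Nat.count_iff_forall.2 fun i hi => .inl hi).ge
      (Nat.count_monotone Z (Nat.le_add_left _ _))
  have hval : ∀ k, x (v k) = z (Nat.count Z (v 0 + (p + 1)) + k) := fun k => congrFun hw k
  have hval' : ∀ k, x (v' k) = z (Nat.count Z (v' 0 + (p + 1)) + k) := fun k => congrFun hw' k
  have heq : Nat.count Z (v 0 + (p + 1)) = Nat.count Z (v' 0 + (p + 1)) ↔ v = v' := by
    refine ⟨fun h => funext fun k => ?_, fun h =>
      congrArg (fun a => Nat.count Z (a + (p + 1))) (congrFun h 0)⟩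
    have h₁ := hnth k
    have h₂ := hnth' k
    rw [h, h₂] at h₁
    omega
  rw [hw, hw']
  rw [hval] at h₀ h₁
  rw [hval', hval'] at hs
  simp only [Fin.val_zero, Fin.val_last, add_zero] at h₀ h₁ hs
  generalize Nat.count Z (v 0 + (p + 1)) = r at *
  generalize Nat.count Z (v' 0 + (p + 1)) = r' at *
  -- Otherwise all knots of the window from `r` on would be at most `s₀`, including the last one.
  obtain ⟨j, hj₁, hj₂⟩ : ∃ j, z j ≤ s₀ ∧ s₀ < z (j + 1) := by
    by_contra! hcon
    have : ∀ d, z (r + d) ≤ s₀ := by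
      intro d
      induction d with
      | zero => exact h₀
      | succ d ih => exact hcon _ ih
    exact absurd (this (p + 1)) (not_le.2 h₁)
  have hlow : ∀ i, z i ≤ s₀ → i ≤ j := by
    intro i hi
    by_contra hcon
    exact absurd (hz (show j + 1 ≤ i by omega)) (by linarith)
  have hupp : ∀ i, s₀ < z (i + (p + 1)) → j ≤ i + p := by
    intro i hi
    by_contra hcon
    exact absurd (hz (show i + (p + 1) ≤ j by omega)) (by linarith)
  have hrj := hlow _ h₀
  rw [dualFunctional_knotWindow hz hj₁ hj₂ (by omega) hrj (hupp _ h₁) (hlow _ hs.1) (hupp _ hs.2)]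
  simp only [heq]

/-! ### Local linear independence of the blending functions -/

/-- A polynomial with infinitely many roots is zero; used in one variable at a time, this allows a
tensor product of functionals to be applied to a relation known only on a grid. -/
lemma sum_map_mul_map_eq_zero {ι : Type*} {t : Finset ι} {c : ι → ℝ} {P Q : ι → ℝ[X]} {S₁ S₂ : Set ℝ}
    (hS₁ : S₁.Infinite) (hS₂ : S₂.Infinite)
    (h : ∀ x ∈ S₁, ∀ y ∈ S₂, ∑ g ∈ t, c g * ((P g).eval x * (Q g).eval y) = 0)
    (φ ψ : ℝ[X] →ₗ[ℝ] ℝ) : ∑ g ∈ t, c g * (φ (P g) * ψ (Q g)) = 0 := by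
  have h₁ : ∀ y ∈ S₂, ∑ g ∈ t, c g * (φ (P g) * (Q g).eval y) = 0 := by
    intro y hy
    have : ∑ g ∈ t, (c g * (Q g).eval y) • P g = 0 := by
      refine Polynomial.eq_zero_of_infinite_isRoot _ (hS₁.mono fun x hx => ?_)
      simp only [Set.mem_ofPred_eq, IsRoot.def, eval_finsetSum, eval_smul, smul_eq_mul]
      rw [← h x hx y hy]
      exact Finset.sum_congr rfl fun g _ => by ring
    have := congrArg φ this
    simp only [map_sum, map_smul, smul_eq_mul, map_zero] at this
    rw [← this]
    exact Finset.sum_congr rfl fun g _ => by ring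
  have : ∑ g ∈ t, (c g * φ (P g)) • Q g = 0 := by
    refine Polynomial.eq_zero_of_infinite_isRoot _ (hS₂.mono fun y hy => ?_)
    simp only [Set.mem_ofPred_eq, IsRoot.def, eval_finsetSum, eval_smul, smul_eq_mul]
    rw [← h₁ y hy]
    exact Finset.sum_congr rfl fun g _ => by ring
  have := congrArg ψ this
  simp only [map_sum, map_smul, smul_eq_mul, map_zero] at this
  rw [← this]
  exact Finset.sum_congr rfl fun g _ => by ring

/-- To the right of a parameter there are infinitely many close parameters without knots in between. -/
lemma exists_infinite_right {u : Set I} (hu : IsOpen u) {s₀ : I} (hs₀ : s₀ ∈ u) (h₁ : (s₀ : ℝ) < 1)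
    {F : Set ℝ} (hF : F.Finite) :
    ∃ S : Set ℝ, S.Infinite ∧ ∀ s ∈ S, ∃ h : s ∈ I, (⟨s, h⟩ : I) ∈ u ∧
      ∀ y ∈ F, (y ≤ s ↔ y ≤ (s₀ : ℝ)) := by
  obtain ⟨u', hu', rfl⟩ := isOpen_induced_iff.1 hu
  have e₁ : ∀ᶠ s in nhdsWithin (s₀ : ℝ) (Set.Ioi (s₀ : ℝ)), s ∈ u' :=
    nhdsWithin_le_nhds (hu'.mem_nhds hs₀)
  have e₂ : ∀ᶠ s in nhdsWithin (s₀ : ℝ) (Set.Ioi (s₀ : ℝ)), s < 1 :=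
    nhdsWithin_le_nhds (Iio_mem_nhds h₁)
  have e₃ : ∀ᶠ s in nhdsWithin (s₀ : ℝ) (Set.Ioi (s₀ : ℝ)), (s₀ : ℝ) < s := self_mem_nhdsWithin
  have e₄ : ∀ᶠ s in nhdsWithin (s₀ : ℝ) (Set.Ioi (s₀ : ℝ)), ∀ y ∈ F, (y ≤ s ↔ y ≤ (s₀ : ℝ)) := by
    refine (Filter.eventually_all_finite hF).2 fun y _ => ?_
    rcases le_or_gt y (s₀ : ℝ) with hy | hy
    · exact e₃.mono fun s hs => ⟨fun _ => hy, fun _ => hy.trans hs.le⟩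
    · have : ∀ᶠ s in nhdsWithin (s₀ : ℝ) (Set.Ioi (s₀ : ℝ)), s < y :=
        nhdsWithin_le_nhds (Iio_mem_nhds hy)
      exact this.mono fun s hs => ⟨fun h => absurd h hs.not_ge, fun h => absurd h hy.not_ge⟩
  obtain ⟨b, hb, hsub⟩ :=
    mem_nhdsGT_iff_exists_Ioo_subset.1 (e₁.and (e₂.and (e₃.and e₄)))
  refine ⟨_, Set.Ioo_infinite hb, fun s hs => ?_⟩
  obtain ⟨hs₁, hs₂, hs₃, hs₄⟩ := hsub hs
  exact ⟨⟨s₀.2.1.trans hs₃.le, hs₂.le⟩, hs₁, hs₄⟩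

lemma IsOpenKnotVector.mem_unitInterval {p m : ℕ} {s : ℕ → ℝ} (h : IsOpenKnotVector p m s) {i : ℕ}
    (hi : i ∈ Set.Icc 1 m) : s i ∈ I := by
  have hm := h.length
  have h₁ := h.first 1 le_rfl (by omega)
  have h₂ := h.last m (by omega) le_rfl
  have h₃ := h.monotone ⟨le_rfl, by omega⟩ hi hi.1
  have h₄ := h.monotone hi ⟨by omega, le_rfl⟩ hi.2
  exact ⟨by linarith, by linarith⟩

/-- The last index exceeds the first by at least `p + 1`, so the multiplicity bound prevents the
support from collapsing. -/
lemma IsOpenKnotVector.first_lt_last {p m : ℕ} {s : ℕ → ℝ} (h : IsOpenKnotVector p m s)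
    {v : Fin (p + 2) → ℕ} (hv : StrictMono v) (hvm : ∀ k, v k ∈ Set.Icc 1 m) :
    s (v 0) < s (v (Fin.last (p + 1))) := by
  have key : ∀ (k : ℕ) (hk : k < p + 2), v 0 + k ≤ v ⟨k, hk⟩ := by
    intro k
    induction k with
    | zero => intro _; exact le_rfl
    | succ k ih =>
      intro hk
      have h₁ := ih (by omega)
      have h₂ : v ⟨k, by omega⟩ < v ⟨k + 1, hk⟩ := hv (Fin.mk_lt_mk.2 (by omega))
      omega
  have h₁ : v 0 + (p + 1) ≤ v (Fin.last (p + 1)) := key (p + 1) (by omega)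
  have h₂ := (hvm (Fin.last (p + 1))).2
  have h₃ := (hvm 0).1
  exact (h.multiplicity _ h₃ (by omega)).trans_le
    (h.monotone ⟨by omega, by omega⟩ ⟨by omega, h₂⟩ h₁)

namespace ASTS

variable {p q : ℕ} (T : ASTS p q)

lemma exists_isIndexedAnchor {f : I × I → ℝ} (hf : f ∈ T.basis) :
    ∃ A v w, T.mesh.IsIndexedAnchor p q A v w ∧ f = T.blending v w := by
  obtain ⟨A, v, w, h₁, h₂, h₃, h₄⟩ := hf
  exact ⟨A, v, w, ⟨h₁, h₂, h₃⟩, h₄⟩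

variable {T} {A : Box} {v : Fin (p + 2) → ℕ} {w : Fin (q + 2) → ℕ}

lemma hVector_mem_Icc (hA : T.mesh.IsIndexedAnchor p q A v w) (k : Fin (p + 2)) :
    v k ∈ Set.Icc 1 T.mesh.m :=
  TMesh.mem_hIndices_bounds hA.vVector.left_le_right (hA.hVector.mem k)

lemma vVector_mem_Icc (hA : T.mesh.IsIndexedAnchor p q A v w) (k : Fin (q + 2)) :
    w k ∈ Set.Icc 1 T.mesh.n :=
  TMesh.mem_vIndices_bounds hA.hVector.left_le_right (hA.vVector.mem k)

lemma monotone_hKnot_comp (hA : T.mesh.IsIndexedAnchor p q A v w) :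
    Monotone fun k => T.hKnot (v k) := fun _ _ hab =>
  T.hKnot_open.monotone (hVector_mem_Icc hA _) (hVector_mem_Icc hA _)
    (hA.hVector.strictMono.monotone hab)

lemma monotone_vKnot_comp (hA : T.mesh.IsIndexedAnchor p q A v w) :
    Monotone fun k => T.vKnot (w k) := fun _ _ hab =>
  T.vKnot_open.monotone (vVector_mem_Icc hA _) (vVector_mem_Icc hA _)
    (hA.vVector.strictMono.monotone hab)

/-- There are finitely many knots, so the same grid to the upper right of `x₀` works for all anchors
simultaneously. Staying below 1 leaves room for it in the unit square. -/
lemma exists_infinite_forall_blending (T : ASTS p q) {U : Set (I × I)} (hU : IsOpen U)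
    {x₀ : I × I} (hx₀ : x₀ ∈ U) (h₁ : (x₀.1 : ℝ) < 1) (h₂ : (x₀.2 : ℝ) < 1) :
    ∃ S₁ S₂ : Set ℝ, S₁.Infinite ∧ S₂.Infinite ∧ ∀ s ∈ S₁, ∀ t ∈ S₂, ∃ x ∈ U,
      ∀ A v w, T.mesh.IsIndexedAnchor p q A v w → T.blending v w x =
        (bSplinePiece x₀.1 p fun k => T.hKnot (v k)).eval s *
          (bSplinePiece x₀.2 q fun k => T.vKnot (w k)).eval t := by
  obtain ⟨u₁, u₂, hu₁, hu₂, hm₁, hm₂, hsub⟩ := isOpen_prod_iff.1 hU x₀.1 x₀.2 hx₀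
  obtain ⟨S₁, hS₁, hS₁'⟩ :=
    exists_infinite_right hu₁ hm₁ h₁ ((Set.finite_Icc 1 T.mesh.m).image T.hKnot)
  obtain ⟨S₂, hS₂, hS₂'⟩ :=
    exists_infinite_right hu₂ hm₂ h₂ ((Set.finite_Icc 1 T.mesh.n).image T.vKnot)
  refine ⟨S₁, S₂, hS₁, hS₂, fun s hs t ht => ?_⟩
  obtain ⟨hsI, hsu, hsF⟩ := hS₁' s hs
  obtain ⟨htI, htu, htF⟩ := hS₂' t ht
  refine ⟨(⟨s, hsI⟩, ⟨t, htI⟩), hsub ⟨hsu, htu⟩, fun A v w hA => ?_⟩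
  rw [blending, bSpline_eq_eval_bSplinePiece (s₀ := x₀.1) p _ fun k =>
      hsF _ ⟨_, hVector_mem_Icc hA k, rfl⟩,
    bSpline_eq_eval_bSplinePiece (s₀ := x₀.2) q _ fun k => htF _ ⟨_, vVector_mem_Icc hA k, rfl⟩]

/-- At the lower left corner of the support, the dual functionals of the function take the value 1
on its own pieces. -/
lemma exists_ne_zero (T : ASTS p q) {f : I × I → ℝ} (hf : f ∈ T.basis) : ∃ x, f x ≠ 0 := by
  obtain ⟨A, v, w, hA, rfl⟩ := T.exists_isIndexedAnchor hf
  have hv := T.hKnot_open.first_lt_last hA.hVector.strictMono (hVector_mem_Icc hA)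
  have hw := T.vKnot_open.first_lt_last hA.vVector.strictMono (vVector_mem_Icc hA)
  have hv₁ := (T.hKnot_open.mem_unitInterval (hVector_mem_Icc hA (Fin.last _))).2
  have hw₁ := (T.vKnot_open.mem_unitInterval (vVector_mem_Icc hA (Fin.last _))).2
  let x₀ : I × I := (⟨_, T.hKnot_open.mem_unitInterval (hVector_mem_Icc hA 0)⟩,
    ⟨_, T.vKnot_open.mem_unitInterval (vVector_mem_Icc hA 0)⟩)
  obtain ⟨S₁, S₂, hS₁, hS₂, h⟩ := T.exists_infinite_forall_blending isOpen_univ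
    (Set.mem_univ x₀) (hv.trans_le hv₁) (hw.trans_le hw₁)
  by_contra! hcon
  have := sum_map_mul_map_eq_zero (t := {()}) (c := fun _ => 1)
    (P := fun _ => bSplinePiece x₀.1 p fun k => T.hKnot (v k))
    (Q := fun _ => bSplinePiece x₀.2 q fun k => T.vKnot (w k)) hS₁ hS₂ (fun s hs t ht => by
      obtain ⟨x, -, hx⟩ := h s hs t ht
      rw [Finset.sum_singleton, ← hx A v w hA, hcon x, mul_zero])
    (dualFunctional p fun k => T.hKnot (v k)) (dualFunctional q fun k => T.vKnot (w k))
  rw [Finset.sum_singleton,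
    dualFunctional_bSplinePiece T.hKnot_open.monotone hA.hVector.strictMono hA.hVector.strictMono
      (hVector_mem_Icc hA) (hVector_mem_Icc hA) (hA.hVector.overlap hA.hVector) le_rfl hv,
    dualFunctional_bSplinePiece T.vKnot_open.monotone hA.vVector.strictMono hA.vVector.strictMono
      (vVector_mem_Icc hA) (vVector_mem_Icc hA) (hA.vVector.overlap hA.vVector) le_rfl hw] at this
  simp at this

/-- Local linear independence: in a linear combination of blending functions that vanishes on an open
set, the functions that do not vanish on this set have coefficient zero. -/
theorem coeff_eq_zero_of_sum_eq_zero (T : ASTS p q) {t : Finset (I × I → ℝ)}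
    (ht : ∀ g ∈ t, g ∈ T.basis) {c : (I × I → ℝ) → ℝ} {U : Set (I × I)} (hU : IsOpen U)
    (hsum : ∀ x ∈ U, ∑ g ∈ t, c g * g x = 0) {f : I × I → ℝ} (hf : f ∈ t) {x₀ : I × I}
    (hx₀ : x₀ ∈ U) (hfx₀ : f x₀ ≠ 0) : c f = 0 := by
  have hex : ∀ g : I × I → ℝ, ∃ A v w, g ∈ t → T.mesh.IsIndexedAnchor p q A v w ∧
      g = T.blending v w := by
    intro g
    by_cases hg : g ∈ t
    · obtain ⟨A, v, w, h⟩ := T.exists_isIndexedAnchor (ht g hg)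
      exact ⟨A, v, w, fun _ => h⟩
    · exact ⟨⟨0, 0, 0, 0⟩, 0, 0, fun h => absurd h hg⟩
  choose A v w hA using hex
  have hAf := (hA f hf).1
  have hprod : bSpline p (fun k => T.hKnot (v f k)) x₀.1 *
      bSpline q (fun k => T.vKnot (w f k)) x₀.2 ≠ 0 := by
    intro h
    apply hfx₀
    rw [(hA f hf).2]
    exact h
  -- A nonzero value places `x₀` in the half-open support, hence strictly below its upper end and
  -- below 1.
  have hs : T.hKnot (v f 0) ≤ x₀.1 ∧ (x₀.1 : ℝ) < T.hKnot (v f (Fin.last (p + 1))) := by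
    by_contra hcon
    exact left_ne_zero_of_mul hprod (bSpline_eq_zero (monotone_hKnot_comp hAf) hcon)
  have ht' : T.vKnot (w f 0) ≤ x₀.2 ∧ (x₀.2 : ℝ) < T.vKnot (w f (Fin.last (q + 1))) := by
    by_contra hcon
    exact right_ne_zero_of_mul hprod (bSpline_eq_zero (monotone_vKnot_comp hAf) hcon)
  obtain ⟨S₁, S₂, hS₁, hS₂, h⟩ := T.exists_infinite_forall_blending hU hx₀
    (hs.2.trans_le (T.hKnot_open.mem_unitInterval (hVector_mem_Icc hAf _)).2)
    (ht'.2.trans_le (T.vKnot_open.mem_unitInterval (vVector_mem_Icc hAf _)).2)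
  have key := sum_map_mul_map_eq_zero (t := t) (c := c)
    (P := fun g => bSplinePiece x₀.1 p fun k => T.hKnot (v g k))
    (Q := fun g => bSplinePiece x₀.2 q fun k => T.vKnot (w g k)) hS₁ hS₂ (fun s hs t' ht' => by
      obtain ⟨x, hxU, hx⟩ := h s hs t' ht'
      rw [← hsum x hxU]
      refine Finset.sum_congr rfl fun g hg => ?_
      rw [← hx _ _ _ (hA g hg).1, ← (hA g hg).2])
    (dualFunctional p fun k => T.hKnot (v f k)) (dualFunctional q fun k => T.vKnot (w f k))
  have hh : ∀ g ∈ t, Overlap (v f) (v g) →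
      dualFunctional p (fun k => T.hKnot (v f k)) (bSplinePiece x₀.1 p fun k => T.hKnot (v g k)) =
        if v f = v g then 1 else 0 := fun g hg ho =>
    dualFunctional_bSplinePiece T.hKnot_open.monotone hAf.hVector.strictMono
      (hA g hg).1.hVector.strictMono (hVector_mem_Icc hAf) (hVector_mem_Icc (hA g hg).1) ho hs.1 hs.2
  have hv : ∀ g ∈ t, Overlap (w f) (w g) →
      dualFunctional q (fun k => T.vKnot (w f k)) (bSplinePiece x₀.2 q fun k => T.vKnot (w g k)) =
        if w f = w g then 1 else 0 := fun g hg ho =>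
    dualFunctional_bSplinePiece T.vKnot_open.monotone hAf.vVector.strictMono
      (hA g hg).1.vVector.strictMono (vVector_mem_Icc hAf) (vVector_mem_Icc (hA g hg).1) ho
      ht'.1 ht'.2
  rw [Finset.sum_eq_single_of_mem f hf, hh f hf (hAf.hVector.overlap hAf.hVector),
    hv f hf (hAf.vVector.overlap hAf.vVector), if_pos rfl, if_pos rfl, one_mul, mul_one] at key
  · exact key
  · intro g hg hgf
    have hne : ¬ (v f = v g ∧ w f = w g) := by
      rintro ⟨h₁, h₂⟩
      exact hgf (by rw [(hA g hg).2, (hA f hf).2, h₁, h₂])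
    -- In the direction in which the two vectors overlap and differ, the functional of `f`
    -- annihilates the piece of `g`; the other factor is arbitrary.
    rcases hAf.overlap_ne_or_overlap_ne T.admissible T.analysisSuitable (hA g hg).1 hne with
      ⟨h₁, h₂⟩ | ⟨h₁, h₂⟩
    · rw [hh g hg h₁, if_neg h₂, zero_mul, mul_zero]
    · rw [hv g hg h₁, if_neg h₂, mul_zero, mul_zero]

end ASTS

/-! ### Linear independence of the hierarchical basis -/

/-- Every function of the hierarchical basis belongs to a level. -/
lemma exists_level_of_mem_hierarchicalBasis {p q : ℕ} {T : ℕ → ASTS p q} {Ω : ℕ → Set (I × I)}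
    {f : I × I → ℝ} : ∀ {L : ℕ}, f ∈ hierarchicalBasis T Ω L → ∃ α ≤ L, f ∈ (T α).basis ∧
      (∀ β, α < β → β ≤ L → ¬ tsupport f ⊆ Ω β) ∧ (0 < α → tsupport f ⊆ Ω α)
  | 0, h => ⟨0, le_rfl, h, fun β h₁ h₂ => by omega, fun h => absurd h (lt_irrefl _)⟩
  | L + 1, h => by
    rcases h with ⟨h, hs⟩ | ⟨h, hs⟩
    · obtain ⟨α, hα, h₁, h₂, h₃⟩ := exists_level_of_mem_hierarchicalBasis h
      refine ⟨α, by omega, h₁, fun β hβ₁ hβ₂ => ?_, h₃⟩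
      rcases hβ₂.eq_or_lt with rfl | hlt
      · exact hs
      · exact h₂ β hβ₁ (by omega)
    · exact ⟨L + 1, le_rfl, h, fun β h₁ h₂ => by omega, fun _ => hs⟩

theorem mainTheorem2 (p q L : ℕ) (T : ℕ → ASTS p q) (Ω : ℕ → Set (I × I))
    (hT : ∀ α < L, (T α).space ≤ (T (α + 1)).space)
    (hΩ : ∀ α < L, Ω (α + 1) ⊆ Ω α) :
    LinearIndepOn ℝ id (hierarchicalBasis T Ω L) := by
  classical
  rw [linearIndepOn_iff']
  intro t c ht hsum
  have hsum' : ∀ x, ∑ g ∈ t, c g * g x = 0 := fun x => by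
    simpa [Finset.sum_apply] using congrFun hsum x
  have hex : ∀ f : I × I → ℝ, ∃ α, f ∈ t → α ≤ L ∧ f ∈ (T α).basis ∧
      (∀ β, α < β → β ≤ L → ¬ tsupport f ⊆ Ω β) ∧ (0 < α → tsupport f ⊆ Ω α) := by
    intro f
    by_cases hf : f ∈ t
    · obtain ⟨α, h⟩ := exists_level_of_mem_hierarchicalBasis (ht hf)
      exact ⟨α, fun _ => h⟩
    · exact ⟨0, fun h => absurd h hf⟩
  choose l hl using hex
  have hΩ' : ∀ α β, α ≤ β → β ≤ L → Ω β ⊆ Ω α := by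
    intro α β hαβ
    induction β, hαβ using Nat.le_induction with
    | base => exact fun _ => subset_rfl
    | succ β _ ih => exact fun h => (hΩ β (by omega)).trans (ih (by omega))
  have key : ∀ α, ∀ f ∈ t, l f = α → c f = 0 := by
    intro α
    induction α using Nat.strong_induction_on with
    | _ α ih =>
      intro f hf hfα
      obtain ⟨hαL, hfb, hfn, -⟩ := hl f hf
      set U : Set (I × I) := ⋂ g ∈ t.filter (fun g => α < l g), (tsupport g)ᶜ with hUdef
      have hU : IsOpen U :=
        isOpen_biInter_finset fun g _ => (isClosed_tsupport g).isOpen_compl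
      -- At the finest level `U` is the whole square. Below it, a point of the support of `f`
      -- outside the next domain avoids all finer supports; it may be only a limit of points where
      -- `f` is nonzero, but `U` is open.
      obtain ⟨x₀, hx₀, hfx₀⟩ : ∃ x₀ ∈ U, f x₀ ≠ 0 := by
        rcases hαL.eq_or_lt with h | h
        · obtain ⟨x, hx⟩ := (T (l f)).exists_ne_zero hfb
          refine ⟨x, ?_, hx⟩
          simp only [hUdef, Set.mem_iInter]
          intro g hg
          rw [Finset.mem_filter] at hg
          have := (hl g hg.1).1
          omega
        · obtain ⟨y, hy, hyΩ⟩ := Set.not_subset.1 (hfn (l f + 1) (by omega) (by omega))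
          have hyU : y ∈ U := by
            simp only [hUdef, Set.mem_iInter]
            intro g hg hgy
            rw [Finset.mem_filter] at hg
            exact hyΩ (hΩ' (l f + 1) (l g) (by omega) (hl g hg.1).1
              ((hl g hg.1).2.2.2 (by omega) hgy))
          obtain ⟨x, hxU, hx⟩ := mem_closure_iff.1 hy U hU hyU
          exact ⟨x, hxU, hx⟩
      refine (T α).coeff_eq_zero_of_sum_eq_zero (t := t.filter fun g => l g = α) (c := c) ?_ hU ?_
        (Finset.mem_filter.2 ⟨hf, hfα⟩) hx₀ hfx₀
      · intro g hg
        rw [Finset.mem_filter] at hg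
        rw [← hg.2]
        exact (hl g hg.1).2.1
      · intro x hx
        -- The omitted terms vanish on `U`: coarser ones by the induction hypothesis, finer ones
        -- because `x` is outside their supports.
        rw [← hsum' x]
        refine Finset.sum_subset (Finset.filter_subset _ _) fun g hg hgα => ?_
        rw [Finset.mem_filter, not_and] at hgα
        rcases lt_or_gt_of_ne (hgα hg) with h | h
        · rw [ih _ h g hg rfl, zero_mul]
        · have hxg : x ∉ tsupport g := by
            simp only [hUdef, Set.mem_iInter] at hx
            exact hx g (Finset.mem_filter.2 ⟨hg, h⟩)
          rw [image_eq_zero_of_notMem_tsupport hxg, mul_zero]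
  exact fun f hf => key _ f hf rfl
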